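/- Let $Q>1$, let $\eta\colon[0,\infty)\to[0,\infty)$ be a homeomorphism, and let $a_Z,b_Z,a_W,b_W>0$. Then there exist constants $c,C>0$, depending only on $Q$, $\eta$, $a_Z,b_Z,a_W,b_W$, with the following property. Let $(Z,d_Z,\mu)$ and $(W,d_W,\nu)$ be compact, connected metric spaces with Borel measures that are Ahlfors $Q$-regular with constants $(a_Z,b_Z)$ and $(a_W,b_W)$ respectively; that is, $a_Z r^Q\le\mu(B(z,r))\le b_Z r^Q$ for all $z\in Z$ and $0<r\le\operatorname{diam}Z$, and $a_W r^Q\le\nu(B(w,r))\le b_W r^Q$ for all $w\in W$ and $0<r\le\operatorname{diam}W$. Let $\varphi\colon Z\to W$ be an $\eta$-quasisymmetric homeomorphism, i.e. a homeomorphism such that for all $z,z',z''\in Z$ and $t\ge 0$, $d_Z(z,z')\le t\,d_Z(z,z'')$ implies $d_W(\varphi(z),\varphi(z'))\le\eta(t)\,d_W(\varphi(z),\varphi(z''))$. Then for every family $\Gamma$ of paths in $Z$ (continuous maps $\gamma\colon I\to Z$, $I\subseteq\mathbb R$ a nonempty interval, possibly varying with $\gamma$), $$c\,\mathrm{Mod}_Q(\Gamma)\le\mathrm{Mod}_Q(\varphi(\Gamma))\le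 C\,\mathrm{Mod}_Q(\Gamma),$$ where $\varphi(\Gamma)=\{\varphi\circ\gamma:\gamma\in\Gamma\}$. Here $\mathrm{Mod}_Q(\Gamma)\in[0,\infty]$ is the infimum of $\int_Z\rho^Q\,d\mu$ over all Borel functions $\rho\colon Z\to[0,\infty]$ with $\int_\gamma\rho\,ds\ge 1$ for every rectifiable $\gamma\in\Gamma$, where $\int_\gamma\rho\,ds$ is the integral with respect to arclength and the infimum of the empty set is $\infty$; $\mathrm{Mod}_Q(\varphi(\Gamma))$ is defined in the same way with respect to $d_W$ and $\nu$. -/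

import Mathlib

open Set MeasureTheory
open scoped NNReal ENNReal

noncomputable section

/-- A path in `Z`: a continuous map from a (nonempty) interval of `ℝ`, of any kind, into `Z`. -/
structure IntervalPath (Z : Type*) [TopologicalSpace Z] where
  domain : Set ℝ
  ordConnected : domain.OrdConnected
  nonempty : domain.Nonempty
  toFun : domain → Z
  continuous_toFun : Continuous toFun

namespace IntervalPath

/-- The image `φ ∘ γ` of a path under a continuous map. -/
def map {Z W : Type*} [TopologicalSpace Z] [TopologicalSpace W] (φ : C(Z, W))
    (γ : IntervalPath Z) : IntervalPath W where
  domain := γ.domain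
  ordConnected := γ.ordConnected
  nonempty := γ.nonempty
  toFun := φ ∘ γ.toFun
  continuous_toFun := φ.continuous.comp γ.continuous_toFun

variable {Z : Type*} [MetricSpace Z]

/-- The length of a path: the supremum of `∑ d(γ(tᵢ), γ(tᵢ₊₁))` over all partitions. -/
def length (γ : IntervalPath Z) : ℝ≥0∞ := eVariationOn γ.toFun univ

/-- A path is rectifiable if its length is finite. -/
def Rectifiable (γ : IntervalPath Z) : Prop := γ.length < ∞

/-- A base point from which the arclength is measured; path integrals do not depend on it. -/
def basePoint (γ : IntervalPath Z) : γ.domain := ⟨γ.nonempty.some, γ.nonempty.some_mem⟩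

/-- The interval on which the arclength parameterization of a rectifiable path is defined: the
set of all signed lengths of `γ` between the base point and another point of the domain. -/
def arclengthDomain (γ : IntervalPath Z) : Set ℝ :=
  range (variationOnFromTo γ.toFun univ γ.basePoint)

/-- The arclength parameterization of a rectifiable path. -/
def arclengthParam (γ : IntervalPath Z) : ℝ → Z :=
  naturalParameterization γ.toFun univ γ.basePoint

/-- The integral of `ρ` along a rectifiable path, with respect to the arclength
parameterization. -/
def integral (γ : IntervalPath Z) (ρ : Z → ℝ≥0∞) : ℝ≥0∞ :=
  ∫⁻ t in γ.arclengthDomain, ρ (γ.arclengthParam t)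

end IntervalPath

/-- A Borel function `ρ : Z → [0, ∞]` is admissible for the path family `Γ` if its integral along
every rectifiable path of `Γ` is at least `1`. -/
def AdmissibleFor {Z : Type*} [MetricSpace Z] [MeasurableSpace Z]
    (ρ : Z → ℝ≥0∞) (Γ : Set (IntervalPath Z)) : Prop :=
  Measurable ρ ∧ ∀ γ ∈ Γ, γ.Rectifiable → 1 ≤ γ.integral ρ

/-- The `p`-modulus of a path family: the infimum of `∫ ρ ^ p dμ` over all admissible `ρ`. -/
def pathModulus {Z : Type*} [MetricSpace Z] [MeasurableSpace Z] (μ : Measure Z) (p : ℝ)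
    (Γ : Set (IntervalPath Z)) : ℝ≥0∞ :=
  ⨅ (ρ : Z → ℝ≥0∞) (_ : AdmissibleFor ρ Γ), ∫⁻ z, ρ z ^ p ∂μ

/-- Ahlfors `Q`-regularity with constants `a` and `b`:
`a r ^ Q ≤ μ(B(z, r)) ≤ b r ^ Q` for all `z` and all `0 < r ≤ diam Z`. -/
def AhlforsRegular {Z : Type*} [MetricSpace Z] [MeasurableSpace Z] (μ : Measure Z)
    (Q a b : ℝ) : Prop :=
  ∀ (z : Z) (r : ℝ), 0 < r → r ≤ Metric.diam (univ : Set Z) →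
    ENNReal.ofReal (a * r ^ Q) ≤ μ (Metric.ball z r) ∧
      μ (Metric.ball z r) ≤ ENNReal.ofReal (b * r ^ Q)

/-- `φ` is `η`-quasisymmetric: `|z - z'| ≤ t |z - z''|` implies
`|φ z - φ z'| ≤ η(t) |φ z - φ z''|`. -/
def IsQuasisymmetric {Z W : Type*} [MetricSpace Z] [MetricSpace W] (η : ℝ≥0 → ℝ≥0)
    (φ : Z → W) : Prop :=
  ∀ (z z' z'' : Z) (t : ℝ≥0), dist z z' ≤ t * dist z z'' →
    dist (φ z) (φ z') ≤ η t * dist (φ z) (φ z'')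

end

/-!
Since the inverse of a quasisymmetric homeomorphism is quasisymmetric, one inequality suffices. Let
`ρ` be admissible for `φ(Γ)`; we may assume that `ρ` is lower semicontinuous and bounded away from
zero. On the balls `B` around the points of an `ε`-net of `Z` consider the weights
`inf_B (ρ ∘ φ) * diam φ(B) / ε`, and let `σ_ε` be the sum of these weights times the indicator
functions of the doubled balls. Ahlfors regularity and quasisymmetry give
`ε ^ Q * (diam φ(B) / ε) ^ Q ≲ ν(φ(B / 2))`, and the sets `φ(B / 2)` are disjoint, so
`∫ σ_ε ^ Q dμ ≲ ∫ ρ ^ Q dν`. A path that visits `B` and has diameter at least `2 * ε` spends length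
at least `ε` in the doubled ball, and thus pays at least `inf_B (ρ ∘ φ) * diam φ(B)`. As `ε → 0`
these sums dominate the integral of `ρ` along `φ ∘ γ`, hence `liminf ∫_γ σ_ε ≥ 1` for every
rectifiable `γ ∈ Γ`. If `φ ∘ γ` is not rectifiable, then the lower bound on `ρ` makes the lower
limit infinite.

The index from which on `∫_γ σ_ε` is almost `1` depends on `γ`, so `Γ` is exhausted by an increasing
sequence of subfamilies on which it is uniform. By Ziemer's lemma the modulus is continuous along
increasing sequences of path families when `Q > 1`, a consequence of the uniform convexity of `L^Q`.
-/

noncomputable section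

open Filter Topology Metric

/-! ### Arclength -/

theorem isPreconnected_of_ordConnected_subtype {α : Type*} [ConditionallyCompleteLinearOrder α]
    [TopologicalSpace α] [OrderTopology α] [DenselyOrdered α] {s : Set α} [s.OrdConnected]
    {K : Set s} (hK : K.OrdConnected) : IsPreconnected K := by
  rw [← IsInducing.subtypeVal.isPreconnected_image, isPreconnected_iff_ordConnected]
  refine ordConnected_def.2 ?_
  rintro _ ⟨x, hx, rfl⟩ _ ⟨y, hy, rfl⟩ t ht
  exact ⟨⟨t, OrdConnected.out ‹_› x.2 y.2 ht⟩, hK.out hx hy ⟨ht.1, ht.2⟩, rfl⟩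

namespace IntervalPath

variable {Z : Type*} [MetricSpace Z]

instance instOrdConnectedDomain (γ : IntervalPath Z) : γ.domain.OrdConnected := γ.ordConnected

/-- The signed length of a path between the base point and another point of its domain. -/
def arclength (γ : IntervalPath Z) : γ.domain → ℝ :=
  variationOnFromTo γ.toFun univ γ.basePoint

/-- A right inverse of the arclength function of a path, on the arclength interval. -/
def arclengthInv (γ : IntervalPath Z) : ℝ → γ.domain :=
  @Function.invFunOn _ _ ⟨γ.basePoint⟩ γ.arclength univ

/-- The arclength measure of a path, transported to its domain: for a rectifiable path, path
integrals are integrals of `ρ ∘ γ` against this measure. -/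
def arclengthMeasure (γ : IntervalPath Z) : Measure γ.domain :=
  (volume.restrict γ.arclengthDomain).map γ.arclengthInv

variable {γ : IntervalPath Z}

namespace Rectifiable

theorem locallyBoundedVariationOn (h : γ.Rectifiable) :
    LocallyBoundedVariationOn γ.toFun univ :=
  BoundedVariationOn.locallyBoundedVariationOn (f := γ.toFun) (s := univ) h.ne

theorem monotone_arclength (h : γ.Rectifiable) : Monotone γ.arclength :=
  monotoneOn_univ.1 (variationOnFromTo.monotoneOn h.locallyBoundedVariationOn (mem_univ _))

theorem ofReal_arclength_sub (h : γ.Rectifiable) {x y : γ.domain} (hxy : x ≤ y) :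
    ENNReal.ofReal (γ.arclength y - γ.arclength x) = eVariationOn γ.toFun (Icc x y) := by
  rw [arclength, variationOnFromTo.sub_right h.locallyBoundedVariationOn (mem_univ _) (mem_univ _)
    (mem_univ _), variationOnFromTo.eq_of_le _ _ hxy, univ_inter, ENNReal.ofReal_toReal]
  exact ((eVariationOn.mono _ (subset_univ _)).trans_lt h).ne

theorem dist_le (h : γ.Rectifiable) (x y : γ.domain) :
    dist (γ.toFun x) (γ.toFun y) ≤ |γ.arclength x - γ.arclength y| := by
  wlog hxy : x ≤ y generalizing x y
  · rw [dist_comm, abs_sub_comm]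
    exact this y x (le_of_not_ge hxy)
  have hℓ : 0 ≤ γ.arclength y - γ.arclength x := sub_nonneg.2 (h.monotone_arclength hxy)
  rw [abs_sub_comm, abs_of_nonneg hℓ, ← ENNReal.ofReal_le_ofReal_iff hℓ,
    h.ofReal_arclength_sub hxy, ← edist_dist]
  exact eVariationOn.edist_le _ (left_mem_Icc.2 hxy) (right_mem_Icc.2 hxy)

theorem continuous_arclength (h : γ.Rectifiable) : Continuous γ.arclength := by
  rw [continuous_iff_continuousAt]
  intro x
  have hl := variationOnFromTo.tendsto_left (a := γ.basePoint) (b := x) (mem_univ _) (mem_univ _)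
    h.locallyBoundedVariationOn ((γ.continuous_toFun.tendsto x).mono_left nhdsWithin_le_nhds)
  have hr := variationOnFromTo.tendsto_right (a := γ.basePoint) (b := x) (mem_univ _) (mem_univ _)
    h.locallyBoundedVariationOn ((γ.continuous_toFun.tendsto x).mono_left nhdsWithin_le_nhds)
  simp only [univ_inter, dist_self, sub_zero, add_zero] at hl hr
  exact continuousAt_iff_continuous_left'_right'.2 ⟨hl, hr⟩

theorem ordConnected_arclengthDomain (h : γ.Rectifiable) : γ.arclengthDomain.OrdConnected := by
  rw [← isPreconnected_iff_ordConnected, arclengthDomain, ← image_univ]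
  exact (isPreconnected_of_ordConnected_subtype ordConnected_univ).image _
    h.continuous_arclength.continuousOn

end Rectifiable

theorem arclength_arclengthInv {s : ℝ} (hs : s ∈ γ.arclengthDomain) :
    γ.arclength (γ.arclengthInv s) = s := by
  obtain ⟨x, hx⟩ := hs
  exact @Function.invFunOn_eq _ _ univ γ.arclength s ⟨γ.basePoint⟩ ⟨x, mem_univ _, hx⟩

namespace Rectifiable

theorem monotoneOn_arclengthInv (h : γ.Rectifiable) :
    MonotoneOn γ.arclengthInv γ.arclengthDomain := by
  intro s hs t ht hst
  by_contra! hlt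
  have := h.monotone_arclength hlt.le
  rw [arclength_arclengthInv hs, arclength_arclengthInv ht] at this
  exact hlt.ne (congrArg _ (le_antisymm this hst))

theorem aemeasurable_arclengthInv (h : γ.Rectifiable) :
    AEMeasurable γ.arclengthInv (volume.restrict γ.arclengthDomain) :=
  aemeasurable_restrict_of_monotoneOn h.ordConnected_arclengthDomain.measurableSet
    h.monotoneOn_arclengthInv

theorem integral_eq [MeasurableSpace Z] [BorelSpace Z] (h : γ.Rectifiable)
    {ρ : Z → ℝ≥0∞} (hρ : Measurable ρ) :
    γ.integral ρ = ∫⁻ t, ρ (γ.toFun t) ∂γ.arclengthMeasure :=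
  (lintegral_map' (hρ.comp γ.continuous_toFun.measurable).aemeasurable
    h.aemeasurable_arclengthInv).symm

theorem arclengthMeasure_apply (h : γ.Rectifiable) {K : Set γ.domain} (hK : MeasurableSet K) :
    γ.arclengthMeasure K = volume (γ.arclengthInv ⁻¹' K ∩ γ.arclengthDomain) := by
  rw [arclengthMeasure, Measure.map_apply_of_aemeasurable h.aemeasurable_arclengthInv hK,
    Measure.restrict_apply' h.ordConnected_arclengthDomain.measurableSet]

theorem arclengthMeasure_le_eVariationOn (h : γ.Rectifiable) {K : Set γ.domain}
    (hK : K.OrdConnected) : γ.arclengthMeasure K ≤ eVariationOn γ.toFun K := by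
  rw [h.arclengthMeasure_apply hK.measurableSet]
  refine (Real.volume_le_diam _).trans (ediam_le ?_)
  rintro s ⟨hsK, hs⟩ t ⟨htK, ht⟩
  wlog hst : s ≤ t generalizing s t
  · rw [edist_comm]
    exact this t htK ht s hsK hs (le_of_not_ge hst)
  calc edist s t
      = ENNReal.ofReal (γ.arclength (γ.arclengthInv t) - γ.arclength (γ.arclengthInv s)) := by
        rw [arclength_arclengthInv hs, arclength_arclengthInv ht, edist_comm, edist_dist,
          Real.dist_eq, abs_of_nonneg (sub_nonneg.2 hst)]
    _ = eVariationOn γ.toFun (Icc (γ.arclengthInv s) (γ.arclengthInv t)) :=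
        h.ofReal_arclength_sub (h.monotoneOn_arclengthInv hs ht hst)
    _ ≤ eVariationOn γ.toFun K := eVariationOn.mono _ (hK.out hsK htK)

theorem arclengthMeasure_singleton (h : γ.Rectifiable) (x : γ.domain) :
    γ.arclengthMeasure {x} = 0 := by
  have := h.arclengthMeasure_le_eVariationOn (ordConnected_singleton (a := x))
  rwa [eVariationOn.subsingleton _ subsingleton_singleton, nonpos_iff_eq_zero] at this

theorem ofReal_abs_arclength_sub_le_arclengthMeasure (h : γ.Rectifiable) {K : Set γ.domain}
    (hK : K.OrdConnected) {x y : γ.domain} (hx : x ∈ K) (hy : y ∈ K) :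
    ENNReal.ofReal |γ.arclength x - γ.arclength y| ≤ γ.arclengthMeasure K := by
  wlog hxy : x ≤ y generalizing x y
  · rw [abs_sub_comm]
    exact this hy hx (le_of_not_ge hxy)
  rw [abs_sub_comm, abs_of_nonneg (sub_nonneg.2 (h.monotone_arclength hxy)), ← Real.volume_Ioo,
    h.arclengthMeasure_apply hK.measurableSet]
  refine measure_mono fun s hs => ?_
  have hsdom : s ∈ γ.arclengthDomain :=
    h.ordConnected_arclengthDomain.out ⟨x, rfl⟩ ⟨y, rfl⟩ (Ioo_subset_Icc_self hs)
  rw [← arclength_arclengthInv hsdom] at hs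
  exact ⟨hK.out hx hy ⟨(h.monotone_arclength.reflect_lt hs.1).le,
    (h.monotone_arclength.reflect_lt hs.2).le⟩, hsdom⟩

theorem exists_mem_uIcc_abs_arclength_sub_eq (h : γ.Rectifiable) {x y : γ.domain} {ε : ℝ}
    (hε₀ : 0 ≤ ε) (hε : ε ≤ |γ.arclength x - γ.arclength y|) :
    ∃ y' ∈ uIcc x y, |γ.arclength x - γ.arclength y'| = ε := by
  have hconn : IsPreconnected (uIcc x y) :=
    isPreconnected_of_ordConnected_subtype ordConnected_uIcc
  exact hconn.intermediate_value left_mem_uIcc right_mem_uIcc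
    (continuous_const.sub h.continuous_arclength).abs.continuousOn
    ⟨by simpa using hε₀, hε⟩

theorem ofReal_le_arclengthMeasure_inter_closedBall (h : γ.Rectifiable) {K : Set γ.domain}
    (hK : K.OrdConnected) {x y : γ.domain} (hx : x ∈ K) (hy : y ∈ K) {ε : ℝ} (hε₀ : 0 ≤ ε)
    (hε : ε ≤ dist (γ.toFun x) (γ.toFun y)) :
    ENNReal.ofReal ε ≤ γ.arclengthMeasure (K ∩ γ.toFun ⁻¹' closedBall (γ.toFun x) ε) := by
  obtain ⟨y', hy', rfl⟩ := h.exists_mem_uIcc_abs_arclength_sub_eq hε₀ (hε.trans (h.dist_le x y))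
  refine (h.ofReal_abs_arclength_sub_le_arclengthMeasure ordConnected_uIcc left_mem_uIcc
    right_mem_uIcc).trans (measure_mono fun t ht => ⟨hK.uIcc_subset hx hy
      (uIcc_subset_uIcc_left hy' ht), ?_⟩)
  rw [mem_preimage, mem_closedBall']
  refine (h.dist_le x t).trans ?_
  have := (h.monotone_arclength.mapsTo_uIcc (a := x) (b := y')) ht
  simpa only [abs_sub_comm] using abs_sub_left_of_mem_uIcc this

end Rectifiable

end IntervalPath

/-! ### Uniform convexity -/

section UniformConvexity

variable {Q : ℝ}

theorem exists_midpoint_one_rpow_add_le (hQ : 1 < Q) {τ : ℝ} (hτ : 0 < τ) :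
    ∃ δ : ℝ, 0 < δ ∧ ∀ s ∈ Icc 0 (1 - τ), ((s + 1) / 2) ^ Q + δ ≤ (s ^ Q + 1) / 2 := by
  have hQ₀ : 0 ≤ Q := by linarith
  have hcont : Continuous fun s : ℝ => (s ^ Q + 1) / 2 - ((s + 1) / 2) ^ Q :=
    (((Real.continuous_rpow_const hQ₀).add continuous_const).div_const 2).sub
      ((Real.continuous_rpow_const hQ₀).comp (by fun_prop : Continuous fun s : ℝ => (s + 1) / 2))
  have hpos : ∀ s ∈ Icc 0 (1 - τ), 0 < (s ^ Q + 1) / 2 - ((s + 1) / 2) ^ Q := by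
    intro s hs
    have := (strictConvexOn_rpow hQ).2 (mem_Ici.2 hs.1) (mem_Ici.2 zero_le_one)
      (by linarith [hs.2] : s ≠ 1) (by norm_num : (0 : ℝ) < 2⁻¹)
      (by norm_num : (0 : ℝ) < 2⁻¹) (by norm_num)
    rw [smul_eq_mul, smul_eq_mul, ← mul_add, inv_mul_eq_div] at this
    simp only [smul_eq_mul, Real.one_rpow] at this
    linarith
  obtain ⟨δ, hδ, h⟩ := isCompact_Icc.exists_forall_le' hcont.continuousOn hpos
  exact ⟨δ, hδ, fun s hs => by linarith [h s hs]⟩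

theorem exists_midpoint_rpow_add_le_of_mul_le_sub (hQ : 1 < Q) {τ : ℝ} (hτ : 0 < τ) :
    ∃ δ : ℝ, 0 < δ ∧ ∀ a b : ℝ, 0 ≤ a → 0 ≤ b → τ * b ≤ b - a →
      ((a + b) / 2) ^ Q + δ * b ^ Q ≤ (a ^ Q + b ^ Q) / 2 := by
  obtain ⟨δ, hδ, h⟩ := exists_midpoint_one_rpow_add_le hQ hτ
  refine ⟨δ, hδ, fun a b ha hb hab => ?_⟩
  rcases hb.eq_or_lt with rfl | hb
  · obtain rfl : a = 0 := by linarith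
    simp [Real.zero_rpow (by linarith : Q ≠ 0)]
  have hs : a / b ∈ Icc 0 (1 - τ) := ⟨by positivity, by rw [div_le_iff₀ hb]; linarith⟩
  have hmid : (a + b) / 2 = (a / b + 1) / 2 * b := by field_simp
  calc ((a + b) / 2) ^ Q + δ * b ^ Q = (((a / b + 1) / 2) ^ Q + δ) * b ^ Q := by
        rw [hmid, Real.mul_rpow (by positivity) hb.le, add_mul]
    _ ≤ ((a / b) ^ Q + 1) / 2 * b ^ Q := by gcongr; exact h _ hs
    _ = ((a / b * b) ^ Q + b ^ Q) / 2 := by rw [Real.mul_rpow hs.1 hb.le]; ring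
    _ = (a ^ Q + b ^ Q) / 2 := by rw [div_mul_cancel₀ _ hb.ne']

theorem exists_midpoint_rpow_add_le (hQ : 1 < Q) {τ : ℝ≥0} (hτ : 0 < τ) :
    ∃ δ : ℝ≥0, 0 < δ ∧ ∀ a b : ℝ≥0∞,
      (2⁻¹ * a + 2⁻¹ * b) ^ Q + δ * (b - a) ^ Q ≤
        2⁻¹ * a ^ Q + 2⁻¹ * b ^ Q + δ * (τ * b) ^ Q := by
  have hQ₀ : 0 < Q := by linarith
  obtain ⟨δ, hδ, h⟩ := exists_midpoint_rpow_add_le_of_mul_le_sub hQ (τ := τ) hτ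
  lift δ to ℝ≥0 using hδ.le
  refine ⟨δ, mod_cast hδ, fun a b => ?_⟩
  rcases le_or_gt (b - a) (τ * b) with hab | hab
  · gcongr
    exact ENNReal.rpow_arith_mean_le_arith_mean2_rpow _ _ _ _ ENNReal.inv_two_add_inv_two hQ.le
  · refine le_add_right ?_
    induction a with
    | top => simp [ENNReal.top_rpow_of_pos hQ₀]
    | coe a =>
    induction b with
    | top => simp [ENNReal.top_rpow_of_pos hQ₀]
    | coe b =>
    have hab' : (τ * b : ℝ) ≤ b - a := by
      have hlt : τ * b < b - a := mod_cast hab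
      rw [← NNReal.coe_sub (tsub_pos_iff_lt.1 (pos_of_gt hlt)).le]
      exact_mod_cast hlt.le
    have hmid : (2⁻¹ * a + 2⁻¹ * b) ^ Q + δ * b ^ Q ≤ 2⁻¹ * a ^ Q + 2⁻¹ * b ^ Q := by
      rw [← mul_add, ← mul_add, inv_mul_eq_div, inv_mul_eq_div]
      exact_mod_cast h a b a.2 b.2 hab'
    calc (2⁻¹ * a + 2⁻¹ * b : ℝ≥0∞) ^ Q + δ * (b - a : ℝ≥0∞) ^ Q
        ≤ (2⁻¹ * a + 2⁻¹ * b : ℝ≥0∞) ^ Q + δ * (b : ℝ≥0∞) ^ Q := by gcongr; exact tsub_le_self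
      _ ≤ 2⁻¹ * (a : ℝ≥0∞) ^ Q + 2⁻¹ * (b : ℝ≥0∞) ^ Q := by
        rw [show (2⁻¹ : ℝ≥0∞) = (2⁻¹ : ℝ≥0) by simp]
        simp only [← ENNReal.coe_rpow_of_nonneg _ hQ₀.le, ← ENNReal.coe_mul, ← ENNReal.coe_add]
        exact_mod_cast hmid

variable {α : Type*} [MeasurableSpace α] {μ : Measure α}

theorem exists_lintegral_midpoint_rpow_add_le (hQ : 1 < Q) {τ : ℝ≥0} (hτ : 0 < τ) :
    ∃ δ : ℝ≥0, 0 < δ ∧ ∀ f g : α → ℝ≥0∞, Measurable f → Measurable g →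
      ∫⁻ x, (2⁻¹ * f x + 2⁻¹ * g x) ^ Q ∂μ + δ * ∫⁻ x, (g x - f x) ^ Q ∂μ ≤
        2⁻¹ * ∫⁻ x, f x ^ Q ∂μ + 2⁻¹ * ∫⁻ x, g x ^ Q ∂μ + δ * (τ ^ Q * ∫⁻ x, g x ^ Q ∂μ) := by
  have hQ₀ : 0 ≤ Q := by linarith
  obtain ⟨δ, hδ, h⟩ := exists_midpoint_rpow_add_le hQ hτ
  refine ⟨δ, hδ, fun f g hf hg => ?_⟩
  calc ∫⁻ x, (2⁻¹ * f x + 2⁻¹ * g x) ^ Q ∂μ + δ * ∫⁻ x, (g x - f x) ^ Q ∂μ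
      = ∫⁻ x, (2⁻¹ * f x + 2⁻¹ * g x) ^ Q + δ * (g x - f x) ^ Q ∂μ := by
        rw [← lintegral_const_mul' _ _ (by simp), lintegral_add_left (by fun_prop)]
    _ ≤ ∫⁻ x, 2⁻¹ * f x ^ Q + 2⁻¹ * g x ^ Q + δ * (τ ^ Q * g x ^ Q) ∂μ := by
        refine lintegral_mono fun x => ?_
        rw [← ENNReal.mul_rpow_of_nonneg _ _ hQ₀]
        exact h _ _
    _ = _ := by
        rw [lintegral_add_left (by fun_prop), lintegral_add_left (by fun_prop),
          lintegral_const_mul' _ _ (by simp), lintegral_const_mul' _ _ (by simp),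
          lintegral_const_mul' _ _ (by simp), lintegral_const_mul' _ _ (by simp [hQ₀])]

theorem exists_lintegral_sub_rpow_le (hQ : 1 < Q) {M θ : ℝ≥0∞} (hM : M ≠ ∞) (hθ : θ ≠ 0) :
    ∃ κ : ℝ≥0∞, 0 < κ ∧ ∀ f g : α → ℝ≥0∞, Measurable f → Measurable g → ∀ A ≤ M,
      ∫⁻ x, f x ^ Q ∂μ ≤ A + κ → ∫⁻ x, g x ^ Q ∂μ ≤ A + κ →
      A ≤ ∫⁻ x, (2⁻¹ * f x + 2⁻¹ * g x) ^ Q ∂μ + κ → ∫⁻ x, (g x - f x) ^ Q ∂μ ≤ θ := by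
  have hQ₀ : 0 < Q := by linarith
  obtain ⟨τ, hτ, hτM⟩ : ∃ τ : ℝ≥0, 0 < τ ∧ (τ : ℝ≥0∞) ^ Q * (M + 1) ≤ θ / 2 := by
    have hpos : 0 < (θ / 2 / (M + 1)) ^ Q⁻¹ :=
      ENNReal.rpow_pos_of_nonneg (ENNReal.div_pos (by simpa using hθ) (by finiteness))
        (by positivity)
    obtain ⟨τ, hτ, hτM⟩ := ENNReal.lt_iff_exists_nnreal_btwn.1 hpos
    exact ⟨τ, mod_cast hτ, ENNReal.mul_le_of_le_div ((ENNReal.le_rpow_inv_iff hQ₀).1 hτM.le)⟩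
  obtain ⟨δ, hδ, h⟩ := exists_lintegral_midpoint_rpow_add_le (μ := μ) hQ hτ
  have hδ₀ : (δ : ℝ≥0∞) ≠ 0 := by simpa using hδ.ne'
  refine ⟨min 1 (δ * (θ / 2) / 2), by simp [hδ.ne', hθ], fun f g hf hg A hA hfA hgA hmid => ?_⟩
  set κ := min 1 (δ * (θ / 2) / 2)
  have hκ : κ + κ ≤ δ * (θ / 2) :=
    (add_le_add (min_le_right _ _) (min_le_right _ _)).trans (ENNReal.add_halves _).le
  have hg₁ : ∫⁻ x, g x ^ Q ∂μ ≤ M + 1 := hgA.trans (add_le_add hA (min_le_left _ _))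
  have key : A + δ * ∫⁻ x, (g x - f x) ^ Q ∂μ ≤ A + δ * θ :=
    calc A + δ * ∫⁻ x, (g x - f x) ^ Q ∂μ
        ≤ ∫⁻ x, (2⁻¹ * f x + 2⁻¹ * g x) ^ Q ∂μ + δ * ∫⁻ x, (g x - f x) ^ Q ∂μ + κ := by
          rw [add_right_comm]
          gcongr
      _ ≤ 2⁻¹ * (A + κ) + 2⁻¹ * (A + κ) + δ * (τ ^ Q * (M + 1)) + κ := by
          refine add_le_add_left ((h f g hf hg).trans ?_) _
          gcongr
      _ ≤ A + κ + δ * (θ / 2) + κ := by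
          grw [hτM, ← add_mul, ENNReal.inv_two_add_inv_two, one_mul]
      _ = A + (κ + κ) + δ * (θ / 2) := by ring
      _ ≤ A + δ * (θ / 2) + δ * (θ / 2) := by gcongr
      _ = A + δ * θ := by rw [add_assoc, ← mul_add, ENNReal.add_halves]
  rw [ENNReal.add_le_add_iff_left (ne_top_of_le_ne_top hM hA)] at key
  exact (ENNReal.mul_le_mul_iff_right hδ₀ ENNReal.coe_ne_top).1 key

theorem lintegral_iSup_rpow_le (hQ : 0 < Q) {g : ℕ → α → ℝ≥0∞} (hg : ∀ m, Measurable (g m))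
    (hmono : Monotone g) {B : ℝ≥0∞} (hB : ∀ m, ∫⁻ x, g m x ^ Q ∂μ ≤ B) :
    ∫⁻ x, (⨆ m, g m x) ^ Q ∂μ ≤ B := by
  have hsup : ∀ x, (⨆ m, g m x) ^ Q = ⨆ m, g m x ^ Q := fun x =>
    (ENNReal.orderIsoRpow Q hQ).map_iSup _
  simp only [hsup]
  rw [lintegral_iSup (fun m => (hg m).pow_const Q)
    fun m n hmn x => ENNReal.rpow_le_rpow (hmono hmn x) hQ.le]
  exact iSup_le hB

theorem lintegral_add_sum_rpow_le {ι : Type*} (hQ : 1 ≤ Q) {f : α → ℝ≥0∞} (hf : Measurable f)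
    {d : ι → α → ℝ≥0∞} (hd : ∀ j, Measurable (d j)) (s : Finset ι) :
    (∫⁻ x, (f x + ∑ j ∈ s, d j x) ^ Q ∂μ) ^ (1 / Q) ≤
      (∫⁻ x, f x ^ Q ∂μ) ^ (1 / Q) + ∑ j ∈ s, (∫⁻ x, d j x ^ Q ∂μ) ^ (1 / Q) := by
  induction s using Finset.cons_induction with
  | empty => simp
  | cons j s hj ih =>
    simp only [Finset.sum_cons, add_left_comm (f _), add_left_comm ((∫⁻ x, f x ^ Q ∂μ) ^ (1 / Q))]
    exact (ENNReal.lintegral_Lp_add_le (hd j).aemeasurable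
      (hf.add (Finset.measurable_fun_sum _ fun i _ => hd i)).aemeasurable hQ).trans
      (add_le_add_right ih _)

theorem le_add_sum_range_tsub (a : ℕ → ℝ≥0∞) (m : ℕ) :
    a m ≤ a 0 + ∑ j ∈ Finset.range m, (a (j + 1) - a j) := by
  induction m with
  | zero => simp
  | succ m ih =>
    rw [Finset.sum_range_succ, ← add_assoc]
    exact le_add_tsub.trans (add_le_add_left ih _)

theorem exists_frequently_le_lintegral_rpow_le (hQ : 1 ≤ Q) {ρ : ℕ → α → ℝ≥0∞}
    (hρ : ∀ k, Measurable (ρ k)) {A B : ℝ≥0∞} (hAB : A < B)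
    (hA : ∀ᶠ k in atTop, ∫⁻ x, ρ k x ^ Q ∂μ ≤ A)
    (hcauchy : ∀ θ : ℝ≥0∞, θ ≠ 0 → ∀ᶠ k in atTop, ∀ l ≥ k, ∫⁻ x, (ρ l x - ρ k x) ^ Q ∂μ ≤ θ) :
    ∃ g : α → ℝ≥0∞, Measurable g ∧ ∫⁻ x, g x ^ Q ∂μ ≤ B ∧ ∃ᶠ k in atTop, ρ k ≤ g := by
  have hQ₀ : 0 < Q := by linarith
  have hgap : B ^ (1 / Q) - A ^ (1 / Q) ≠ 0 :=
    (tsub_pos_of_lt (ENNReal.rpow_lt_rpow hAB (by positivity))).ne'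
  obtain ⟨ε, hε, hεsum⟩ := ENNReal.exists_pos_sum_of_countable hgap ℕ
  obtain ⟨n, hn, hnρ⟩ := extraction_forall_of_eventually fun j =>
    hA.and (hcauchy ((ε j : ℝ≥0∞) ^ Q) (by simp [(hε j).ne']))
  let d : ℕ → α → ℝ≥0∞ := fun j x => ρ (n (j + 1)) x - ρ (n j) x
  let g : ℕ → α → ℝ≥0∞ := fun m x => ρ (n 0) x + ∑ j ∈ Finset.range m, d j x
  have hd_meas : ∀ j, Measurable (d j) := fun j => (hρ _).sub (hρ _)
  have hg_meas : ∀ m, Measurable (g m) := fun m =>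
    (hρ _).add (Finset.measurable_fun_sum _ fun j _ => hd_meas j)
  have hg_mono : Monotone g := fun m m' hm x => by
    change _ + _ ≤ _ + _
    gcongr
  have hd_le : ∀ j, (∫⁻ x, d j x ^ Q ∂μ) ^ (1 / Q) ≤ ε j := fun j => by
    rw [one_div, ENNReal.rpow_inv_le_iff hQ₀]
    exact (hnρ j).2 _ (hn.monotone j.le_succ)
  have hg_le : ∀ m, ∫⁻ x, g m x ^ Q ∂μ ≤ B := fun m => by
    have hQinv : 0 < 1 / Q := by positivity
    rw [← ENNReal.rpow_le_rpow_iff hQinv]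
    calc (∫⁻ x, g m x ^ Q ∂μ) ^ (1 / Q)
        ≤ (∫⁻ x, ρ (n 0) x ^ Q ∂μ) ^ (1 / Q) +
            ∑ j ∈ Finset.range m, (∫⁻ x, d j x ^ Q ∂μ) ^ (1 / Q) :=
          lintegral_add_sum_rpow_le hQ (hρ _) hd_meas _
      _ ≤ A ^ (1 / Q) + ∑ j ∈ Finset.range m, (ε j : ℝ≥0∞) := by
          gcongr with j
          · exact (hnρ 0).1
          · exact hd_le j
      _ ≤ A ^ (1 / Q) + (B ^ (1 / Q) - A ^ (1 / Q)) := by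
          gcongr
          exact (ENNReal.sum_le_tsum _).trans hεsum.le
      _ = B ^ (1 / Q) := add_tsub_cancel_of_le (ENNReal.rpow_le_rpow hAB.le hQinv.le)
  refine ⟨fun x => ⨆ m, g m x, Measurable.iSup hg_meas,
    lintegral_iSup_rpow_le hQ₀ hg_meas hg_mono hg_le, frequently_atTop.2 fun k =>
    ⟨n k, hn.le_apply, fun x => ?_⟩⟩
  exact (le_add_sum_range_tsub (fun j => ρ (n j) x) k).trans (le_iSup (fun m => g m x) k)

end UniformConvexity

/-! ### Modulus -/

section Modulus

variable {Z : Type*} [MetricSpace Z] [MeasurableSpace Z] {μ : Measure Z} {Q : ℝ}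
  {Γ Γ' : Set (IntervalPath Z)} {ρ ρ' : Z → ℝ≥0∞}

namespace AdmissibleFor

theorem mono (h : AdmissibleFor ρ Γ) (hρ' : Measurable ρ') (hle : ρ ≤ ρ') : AdmissibleFor ρ' Γ :=
  ⟨hρ', fun γ hγ hr => (h.2 γ hγ hr).trans (lintegral_mono fun _ => hle _)⟩

theorem subset (h : AdmissibleFor ρ Γ) (hΓ : Γ' ⊆ Γ) : AdmissibleFor ρ Γ' :=
  ⟨h.1, fun γ hγ => h.2 γ (hΓ hγ)⟩

theorem pathModulus_le (h : AdmissibleFor ρ Γ) : pathModulus μ Q Γ ≤ ∫⁻ z, ρ z ^ Q ∂μ :=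
  iInf₂_le ρ h

theorem midpoint (h : AdmissibleFor ρ Γ) (h' : AdmissibleFor ρ' Γ) :
    AdmissibleFor (fun z => 2⁻¹ * ρ z + 2⁻¹ * ρ' z) Γ := by
  refine ⟨(h.1.const_mul _).add (h'.1.const_mul _), fun γ hγ hr => ?_⟩
  calc (1 : ℝ≥0∞) = 2⁻¹ * 1 + 2⁻¹ * 1 := by rw [← add_mul, ENNReal.inv_two_add_inv_two, one_mul]
    _ ≤ 2⁻¹ * γ.integral ρ + 2⁻¹ * γ.integral ρ' := by
        gcongr
        exacts [h.2 γ hγ hr, h'.2 γ hγ hr]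
    _ ≤ γ.integral fun z => 2⁻¹ * ρ z + 2⁻¹ * ρ' z := by
        unfold IntervalPath.integral
        rw [← lintegral_const_mul' _ _ (by simp), ← lintegral_const_mul' _ _ (by simp)]
        exact le_lintegral_add _ _

end AdmissibleFor

theorem pathModulus_mono (hΓ : Γ' ⊆ Γ) : pathModulus μ Q Γ' ≤ pathModulus μ Q Γ :=
  le_iInf₂ fun ρ h => iInf₂_le ρ (h.subset hΓ)

theorem exists_admissibleFor_lt {M : ℝ≥0∞} (h : pathModulus μ Q Γ < M) :
    ∃ ρ, AdmissibleFor ρ Γ ∧ ∫⁻ z, ρ z ^ Q ∂μ < M := by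
  simpa only [pathModulus, iInf_lt_iff, exists_prop] using h

theorem eventually_lintegral_sub_rpow_le_of_tendsto_iSup_pathModulus (hQ : 1 < Q)
    {Γ : ℕ → Set (IntervalPath Z)} (hΓ : Monotone Γ) (hfin : ⨆ k, pathModulus μ Q (Γ k) ≠ ∞)
    {ρ : ℕ → Z → ℝ≥0∞} (hρ : ∀ k, AdmissibleFor (ρ k) (Γ k))
    (hlim : Tendsto (fun k => ∫⁻ z, ρ k z ^ Q ∂μ) atTop (𝓝 (⨆ k, pathModulus μ Q (Γ k))))
    {θ : ℝ≥0∞} (hθ : θ ≠ 0) :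
    ∀ᶠ k in atTop, ∀ l ≥ k, ∫⁻ z, (ρ l z - ρ k z) ^ Q ∂μ ≤ θ := by
  set A := ⨆ k, pathModulus μ Q (Γ k)
  obtain ⟨κ, hκ, hconvex⟩ := exists_lintegral_sub_rpow_le (μ := μ) hQ hfin hθ
  have hmod : Tendsto (fun k => pathModulus μ Q (Γ k) + κ) atTop (𝓝 (A + κ)) :=
    (tendsto_atTop_iSup fun k l hkl => pathModulus_mono (hΓ hkl)).add tendsto_const_nhds
  have hAκ : A < A + κ := ENNReal.lt_add_right hfin hκ.ne'
  have hbound := hlim.eventually_le_const hAκ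
  filter_upwards [eventually_forall_ge_atTop.2 hbound, hmod.eventually_const_le hAκ]
    with k hk hAk l hkl
  refine hconvex _ _ (hρ k).1 (hρ l).1 A le_rfl (hk k le_rfl) (hk l hkl) (hAk.trans ?_)
  gcongr
  exact ((hρ k).midpoint ((hρ l).subset (hΓ hkl))).pathModulus_le

theorem exists_admissibleFor_tendsto_iSup_pathModulus {Γ : ℕ → Set (IntervalPath Z)}
    (hΓ : Monotone Γ) (hfin : ⨆ k, pathModulus μ Q (Γ k) ≠ ∞) :
    ∃ ρ : ℕ → Z → ℝ≥0∞, (∀ k, AdmissibleFor (ρ k) (Γ k)) ∧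
      Tendsto (fun k => ∫⁻ z, ρ k z ^ Q ∂μ) atTop (𝓝 (⨆ k, pathModulus μ Q (Γ k))) := by
  have hlt : ∀ k, pathModulus μ Q (Γ k) < pathModulus μ Q (Γ k) + 2⁻¹ ^ k := fun k =>
    ENNReal.lt_add_right (ne_top_of_le_ne_top hfin (le_iSup (fun k => pathModulus μ Q (Γ k)) k))
      (by simp)
  choose ρ hρ hρlt using fun k => exists_admissibleFor_lt (hlt k)
  have hmod : Tendsto (fun k => pathModulus μ Q (Γ k)) atTop (𝓝 (⨆ k, pathModulus μ Q (Γ k))) :=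
    tendsto_atTop_iSup fun k l hkl => pathModulus_mono (hΓ hkl)
  have hpow : Tendsto (fun k : ℕ => (2⁻¹ : ℝ≥0∞) ^ k) atTop (𝓝 0) :=
    ENNReal.tendsto_pow_atTop_nhds_zero_of_lt_one (by simp)
  refine ⟨ρ, hρ, tendsto_of_tendsto_of_tendsto_of_le_of_le hmod ?_
    (fun k => (hρ k).pathModulus_le) fun k => (hρlt k).le⟩
  simpa only [add_zero] using hmod.add hpow

/-- Ziemer's lemma. -/
theorem pathModulus_iUnion_eq_iSup (hQ : 1 < Q) {Γ : ℕ → Set (IntervalPath Z)}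
    (hΓ : Monotone Γ) : pathModulus μ Q (⋃ k, Γ k) = ⨆ k, pathModulus μ Q (Γ k) := by
  refine le_antisymm (le_of_forall_gt fun B hB => ?_)
    (iSup_le fun k => pathModulus_mono (subset_iUnion Γ k))
  obtain ⟨B', hAB', hB'⟩ := exists_between hB
  obtain ⟨A', hAA', hA'⟩ := exists_between hAB'
  obtain ⟨ρ, hρ, hlim⟩ := exists_admissibleFor_tendsto_iSup_pathModulus hΓ hB.ne_top
  obtain ⟨g, hg, hgB, hρg⟩ := exists_frequently_le_lintegral_rpow_le (μ := μ) hQ.le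
    (fun k => (hρ k).1) hA' (hlim.eventually_le_const hAA') fun θ hθ =>
    eventually_lintegral_sub_rpow_le_of_tendsto_iSup_pathModulus hQ hΓ hB.ne_top hρ hlim hθ
  have hadm : AdmissibleFor g (⋃ k, Γ k) := by
    refine ⟨hg, fun γ hγ hr => ?_⟩
    obtain ⟨k, hk⟩ := mem_iUnion.1 hγ
    obtain ⟨l, hkl, hl⟩ := frequently_atTop.1 hρg k
    exact ((hρ l).mono hg hl).2 γ (hΓ hkl hk) hr
  exact hadm.pathModulus_le.trans_lt (hgB.trans_lt hB')

theorem pathModulus_le_of_eventually_one_le_integral (hQ : 1 < Q) {σ : ℕ → Z → ℝ≥0∞}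
    (hσ : ∀ n, Measurable (σ n)) {M : ℝ≥0∞} (hM : ∀ n, ∫⁻ z, σ n z ^ Q ∂μ ≤ M)
    (hΓ : ∀ γ ∈ Γ, γ.Rectifiable → ∀ᶠ n in atTop, 1 ≤ γ.integral (σ n)) :
    pathModulus μ Q Γ ≤ M := by
  let Γ' : ℕ → Set (IntervalPath Z) := fun k =>
    {γ ∈ Γ | γ.Rectifiable → ∀ n ≥ k, 1 ≤ γ.integral (σ n)}
  have hΓ' : Monotone Γ' := fun k l hkl γ hγ => ⟨hγ.1, fun hr n hn => hγ.2 hr n (hkl.trans hn)⟩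
  have hcover : Γ ⊆ ⋃ k, Γ' k := by
    intro γ hγ
    rw [mem_iUnion]
    by_cases hr : γ.Rectifiable
    · obtain ⟨k, hk⟩ := eventually_atTop.1 (hΓ γ hγ hr)
      exact ⟨k, hγ, fun _ => hk⟩
    · exact ⟨0, hγ, fun h => absurd h hr⟩
  have hadm : ∀ k, AdmissibleFor (σ k) (Γ' k) := fun k =>
    ⟨hσ k, fun γ hγ hr => hγ.2 hr k le_rfl⟩
  calc pathModulus μ Q Γ ≤ pathModulus μ Q (⋃ k, Γ' k) := pathModulus_mono hcover
    _ = ⨆ k, pathModulus μ Q (Γ' k) := pathModulus_iUnion_eq_iSup hQ hΓ'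
    _ ≤ M := iSup_le fun k => (hadm k).pathModulus_le.trans (hM k)

theorem pathModulus_le_of_one_le_liminf_integral (hQ : 1 < Q) {σ : ℕ → Z → ℝ≥0∞}
    (hσ : ∀ n, Measurable (σ n)) {M : ℝ≥0∞} (hM : ∀ n, ∫⁻ z, σ n z ^ Q ∂μ ≤ M)
    (hΓ : ∀ γ ∈ Γ, γ.Rectifiable → 1 ≤ liminf (fun n => γ.integral (σ n)) atTop) :
    pathModulus μ Q Γ ≤ M := by
  have hQ₀ : 0 ≤ Q := by linarith
  have hdilate : ∀ a : ℝ≥0, 1 < a → pathModulus μ Q Γ ≤ (a : ℝ≥0∞) ^ Q * M := by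
    intro a ha
    refine pathModulus_le_of_eventually_one_le_integral hQ (fun n => (hσ n).const_mul a)
      (fun n => ?_) fun γ hγ hr => ?_
    · simp only [ENNReal.mul_rpow_of_nonneg _ _ hQ₀]
      rw [lintegral_const_mul' _ _ (by finiteness)]
      gcongr
      exact hM n
    · have hlt : (a : ℝ≥0∞)⁻¹ < liminf (fun n => γ.integral (σ n)) atTop :=
        (ENNReal.inv_lt_one.2 (mod_cast ha)).trans_le (hΓ γ hγ hr)
      filter_upwards [eventually_lt_of_lt_liminf hlt] with n hn
      rw [IntervalPath.integral, lintegral_const_mul' _ _ ENNReal.coe_ne_top,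
        ← ENNReal.mul_inv_cancel (a := a) (mod_cast (zero_lt_one.trans ha).ne')
          ENNReal.coe_ne_top]
      gcongr
      exact hn.le
  have hlim : Tendsto (fun a : ℝ≥0 => (a : ℝ≥0∞) ^ Q * M) (𝓝[>] 1) (𝓝 M) := by
    have hcont : Continuous fun a : ℝ≥0 => (a : ℝ≥0∞) ^ Q :=
      ENNReal.continuous_rpow_const.comp ENNReal.continuous_coe
    have := (hcont.tendsto 1).mono_left (nhdsWithin_le_nhds (s := Ioi 1))
    simp only [ENNReal.coe_one, ENNReal.one_rpow] at this
    simpa using ENNReal.Tendsto.mul_const (b := M) this (Or.inl one_ne_zero)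
  exact ge_of_tendsto hlim (eventually_nhdsWithin_of_forall hdilate)

end Modulus

section Degenerate

variable {Z : Type*} [MetricSpace Z]

theorem IntervalPath.length_of_subsingleton [Subsingleton Z] (γ : IntervalPath Z) :
    γ.length = 0 :=
  eVariationOn.constant_on subsingleton_of_subsingleton

variable [MeasurableSpace Z]

theorem pathModulus_empty (μ : Measure Z) {Q : ℝ} (hQ : 0 < Q) : pathModulus μ Q ∅ = 0 := by
  have hadm : AdmissibleFor (fun _ : Z => 0) (∅ : Set (IntervalPath Z)) :=
    ⟨measurable_const, fun γ hγ => absurd hγ (notMem_empty γ)⟩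
  simpa [hQ] using hadm.pathModulus_le (μ := μ) (Q := Q)

theorem pathModulus_eq_top_of_subsingleton [Subsingleton Z] [BorelSpace Z] (μ : Measure Z) (Q : ℝ)
    {Γ : Set (IntervalPath Z)} (hΓ : Γ.Nonempty) : pathModulus μ Q Γ = ∞ := by
  refine top_le_iff.1 (le_iInf₂ fun ρ hρ => ?_)
  obtain ⟨γ, hγ⟩ := hΓ
  have hrect : γ.Rectifiable := γ.length_of_subsingleton.trans_lt ENNReal.zero_lt_top
  have hzero : γ.arclengthMeasure = 0 := Measure.measure_univ_eq_zero.1 <| le_zero_iff.1 <|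
    (hrect.arclengthMeasure_le_eVariationOn ordConnected_univ).trans γ.length_of_subsingleton.le
  have hone := hρ.2 γ hγ hrect
  rw [hrect.integral_eq hρ.1, hzero, lintegral_zero_measure] at hone
  exact absurd hone (by simp)

end Degenerate

section BallInf

/-- The infimum of `ρ` over the balls of radius `r`: as `r → 0`, these functions increase to `ρ`
when `ρ` is lower semicontinuous. -/
def ballInf {W : Type*} [PseudoMetricSpace W] (ρ : W → ℝ≥0∞) (r : ℝ) (w : W) : ℝ≥0∞ :=
  ⨅ v ∈ ball w r, ρ v

variable {W : Type*} [PseudoMetricSpace W] {ρ : W → ℝ≥0∞}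

theorem ballInf_le {r : ℝ} {v w : W} (h : v ∈ ball w r) : ballInf ρ r w ≤ ρ v := iInf₂_le v h

theorem ballInf_anti {r r' : ℝ} (h : r ≤ r') (w : W) : ballInf ρ r' w ≤ ballInf ρ r w :=
  biInf_mono fun _ hv => ball_subset_ball h hv

theorem measurable_ballInf [MeasurableSpace W] [OpensMeasurableSpace W] (ρ : W → ℝ≥0∞) (r : ℝ) :
    Measurable (ballInf ρ r) := by
  refine measurable_of_Iio fun c => IsOpen.measurableSet ?_
  have : ballInf ρ r ⁻¹' Iio c = ⋃ v ∈ {v | ρ v < c}, ball v r := by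
    ext w
    simp only [ballInf, mem_preimage, mem_Iio, iInf_lt_iff, mem_ofPred_eq, mem_iUnion, exists_prop]
    exact exists_congr fun v => by rw [mem_ball_comm, and_comm]
  rw [this]
  exact isOpen_biUnion fun v _ => isOpen_ball

theorem iSup_ballInf_of_lowerSemicontinuous (hρ : LowerSemicontinuous ρ) (w : W) :
    ⨆ n : ℕ, ballInf ρ (1 / ((n : ℝ) + 1)) w = ρ w := by
  refine le_antisymm (iSup_le fun n => ballInf_le (mem_ball_self (by positivity))) ?_
  refine le_of_forall_lt fun c hc => ?_
  obtain ⟨c', hcc', hc'⟩ := exists_between hc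
  obtain ⟨ε, hε, hball⟩ := Metric.eventually_nhds_iff_ball.1 (hρ w c' hc')
  obtain ⟨n, hn⟩ := exists_nat_one_div_lt hε
  exact hcc'.trans_le (le_iSup_of_le n (le_iInf₂ fun v hv =>
    (hball v (ball_subset_ball hn.le hv)).le))

end BallInf

/-! ### Discretization -/

theorem exists_finset_isSeparated_isCover {X : Type*} [PseudoEMetricSpace X] {s : Set X}
    (hs : TotallyBounded s) {ε : ℝ≥0} (hε : ε ≠ 0) :
    ∃ N : Finset X, IsSeparated ε (N : Set X) ∧ IsCover ε s N := by
  have hpack : packingNumber ε s ≠ ⊤ := by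
    obtain ⟨N, -, hN, hcover⟩ := exists_finite_isCover_of_totallyBounded (half_pos hε.bot_lt).ne' hs
    have h := packingNumber_two_mul_le_externalCoveringNumber (ε / 2) s
    rw [mul_div_cancel₀ _ two_ne_zero] at h
    exact ((h.trans hcover.externalCoveringNumber_le_encard).trans_lt hN.encard_lt_top).ne
  have hfin : (maximalSeparatedSet ε s).Finite := by
    rwa [← encard_ne_top_iff, encard_maximalSeparatedSet hpack]
  refine ⟨hfin.toFinset, ?_, ?_⟩ <;> rw [hfin.coe_toFinset]
  exacts [isSeparated_maximalSeparatedSet, isCover_maximalSeparatedSet hpack]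

theorem pairwiseDisjoint_ball_half_of_isSeparated {X : Type*} [PseudoMetricSpace X] {s : Set X}
    {ε : ℝ≥0} (hs : IsSeparated ε s) : s.PairwiseDisjoint fun i => ball i (ε / 2 : ℝ) := by
  intro x hx y hy hxy
  have hdist : (ε : ℝ) < dist x y := by
    have : (ε : ℝ≥0∞) < edist x y := hs hx hy hxy
    rw [edist_nndist, ENNReal.coe_lt_coe] at this
    exact_mod_cast this
  exact ball_disjoint_ball (by rw [add_halves]; exact hdist.le)

/-- The distance to a point of the set is `1`-Lipschitz, and the intermediate value theorem turns
a covering of the set into a covering of an interval. -/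
theorem ediam_le_sum_of_isPreconnected {W ι : Type*} [PseudoMetricSpace W] {K : Set W}
    (hK : IsPreconnected K) {T : Finset ι} {A : ι → Set W} (hcover : K ⊆ ⋃ i ∈ T, A i) :
    ediam K ≤ ∑ i ∈ T, ediam (A i) := by
  refine ediam_le fun x hx y hy => ?_
  have hlip : LipschitzWith 1 fun w => dist w x := LipschitzWith.dist_left x
  have hIcc : Icc (dist x x) (dist y x) ⊆ ⋃ i ∈ T, (fun w => dist w x) '' A i := by
    rw [← image_iUnion₂]
    exact (hK.intermediate_value hx hy hlip.continuous.continuousOn).trans (image_mono hcover)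
  calc edist x y = volume (Icc (dist x x) (dist y x)) := by simp [edist_dist, dist_comm]
    _ ≤ ∑ i ∈ T, volume ((fun w => dist w x) '' A i) :=
        (measure_mono hIcc).trans (measure_biUnion_finset_le _ _)
    _ ≤ ∑ i ∈ T, ediam (A i) := Finset.sum_le_sum fun i _ =>
        (Real.volume_le_diam _).trans (by simpa using hlip.ediam_image_le (A i))

theorem AhlforsRegular.card_le_of_isSeparated {Z : Type*} [MetricSpace Z] [MeasurableSpace Z]
    [OpensMeasurableSpace Z] {μ : Measure Z} {Q a b : ℝ} (h : AhlforsRegular μ Q a b) (ha : 0 < a)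
    (hb : 0 ≤ b) {ε : ℝ≥0} (hε : 0 < ε) {T : Finset Z} (hT : IsSeparated ε (T : Set Z)) {z : Z}
    {r : ℝ} (hr : 0 ≤ r) (hTz : ∀ i ∈ T, dist i z ≤ r) (hdiam : r + ε ≤ diam (univ : Set Z)) :
    (T.card : ℝ) ≤ b / a * (2 * (r + ε) / ε) ^ Q := by
  have : (0 : ℝ) < ε := hε
  have hpos : 0 < a * (ε / 2 : ℝ) ^ Q := by positivity
  have hmass : (T.card : ℝ≥0∞) * ENNReal.ofReal (a * (ε / 2) ^ Q) ≤
      ENNReal.ofReal (b * (r + ε) ^ Q) :=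
    calc (T.card : ℝ≥0∞) * ENNReal.ofReal (a * (ε / 2) ^ Q)
        = ∑ i ∈ T, ENNReal.ofReal (a * (ε / 2) ^ Q) := by rw [Finset.sum_const, nsmul_eq_mul]
      _ ≤ ∑ i ∈ T, μ (ball i (ε / 2)) :=
          Finset.sum_le_sum fun i _ => (h i (ε / 2) (by positivity) (by linarith)).1
      _ = μ (⋃ i ∈ T, ball i (ε / 2)) :=
          (measure_biUnion_finset (pairwiseDisjoint_ball_half_of_isSeparated hT)
            fun i _ => isOpen_ball.measurableSet).symm
      _ ≤ μ (ball z (r + ε)) := measure_mono <| iUnion₂_subset fun i hi =>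
          ball_subset_ball' (by linarith [hTz i hi])
      _ ≤ ENNReal.ofReal (b * (r + ε) ^ Q) := (h z (r + ε) (by positivity) hdiam).2
  rw [← ENNReal.ofReal_natCast, ← ENNReal.ofReal_mul (Nat.cast_nonneg _),
    ENNReal.ofReal_le_ofReal_iff (by positivity), ← le_div_iff₀ hpos] at hmass
  refine hmass.trans_eq ?_
  rw [show 2 * (r + ε) / (ε : ℝ) = (r + ε) / (ε / 2) by field_simp,
    Real.div_rpow (y := (ε / 2 : ℝ)) (by positivity) (by positivity), div_mul_div_comm]

/-- The weak form of quasisymmetry: points of a ball are mapped, up to the factor `H`, at most as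
far from the image of its centre as points outside of the concentric ball of half the radius. The
radius is halved because the balls of half the radius around the points of a net are disjoint. -/
def IsWeaklyQuasisymmetric {Z W : Type*} [PseudoMetricSpace Z] [PseudoMetricSpace W] (H : ℝ)
    (φ : Z → W) : Prop :=
  ∀ z z' z'' : Z, dist z z' ≤ 2 * dist z z'' → dist (φ z) (φ z') ≤ H * dist (φ z) (φ z'')

namespace IsWeaklyQuasisymmetric

variable {Z W : Type*} [PseudoMetricSpace Z] {H : ℝ}

theorem one_le [Nontrivial Z] [MetricSpace W] {φ : Z → W} (hφ : IsWeaklyQuasisymmetric H φ)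
    (hinj : Function.Injective φ) : 1 ≤ H := by
  obtain ⟨z, z', hz⟩ := exists_pair_ne Z
  have hpos : 0 < dist (φ z) (φ z') := dist_pos.2 (hinj.ne hz)
  have := hφ z z' z' (by linarith [dist_nonneg (x := z) (y := z')])
  exact le_of_mul_le_mul_right (by rwa [one_mul]) hpos

variable [PseudoMetricSpace W] {φ : Z → W}

theorem diam_image_closedBall_le (hφ : IsWeaklyQuasisymmetric H φ) {z z' : Z} {ε : ℝ}
    (hz' : ε ≤ 2 * dist z z') : diam (φ '' closedBall z ε) ≤ 2 * (H * dist (φ z) (φ z')) := by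
  have hsub : φ '' closedBall z ε ⊆ closedBall (φ z) (H * dist (φ z) (φ z')) := by
    rintro _ ⟨p, hp, rfl⟩
    rw [mem_closedBall']
    exact hφ z p z' ((mem_closedBall'.1 hp).trans hz')
  have hnonneg : 0 ≤ H * dist (φ z) (φ z') := by
    simpa using hφ z z z' (by simp)
  exact diam_le_of_subset_closedBall hnonneg hsub

theorem ball_subset_image_ball (hφ : IsWeaklyQuasisymmetric H φ) (hH : 0 < H)
    (hsurj : Function.Surjective φ) (z : Z) (ε : ℝ) :
    ball (φ z) (diam (φ '' closedBall z ε) / (2 * H)) ⊆ φ '' ball z (ε / 2) := by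
  intro w hw
  obtain ⟨z', rfl⟩ := hsurj w
  refine mem_image_of_mem φ (mem_ball'.2 ?_)
  by_contra! hfar
  have hdiam := hφ.diam_image_closedBall_le (z := z) (z' := z') (ε := ε) (by linarith)
  rw [mem_ball', lt_div_iff₀ (by positivity)] at hw
  linarith

end IsWeaklyQuasisymmetric

theorem IsWeaklyQuasisymmetric.ediam_image_closedBall_rpow_le {Z W : Type*} [PseudoMetricSpace Z]
    [MetricSpace W] [BoundedSpace W] [MeasurableSpace W] {ν : Measure W} {Q H a' b' : ℝ}
    {φ : Z → W} (hφ : IsWeaklyQuasisymmetric H φ) (hH : 1 ≤ H) (hsurj : Function.Surjective φ)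
    (hQ : 0 < Q) (ha' : 0 < a') (hν : AhlforsRegular ν Q a' b') (z : Z) (ε : ℝ) :
    ediam (φ '' closedBall z ε) ^ Q ≤
      ENNReal.ofReal ((2 * H) ^ Q / a') * ν (φ '' ball z (ε / 2)) := by
  have hbdd : ∀ s : Set W, Bornology.IsBounded s := fun s => Bornology.IsBounded.all s
  set D := diam (φ '' closedBall z ε)
  rw [show ediam (φ '' closedBall z ε) = ENNReal.ofReal D from
    (ENNReal.ofReal_toReal (hbdd _).ediam_ne_top).symm]
  obtain hD0 | hDpos : D = 0 ∨ 0 < D := diam_nonneg.eq_or_lt'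
  · rw [hD0, ENNReal.ofReal_zero, ENNReal.zero_rpow_of_pos hQ]
    exact zero_le
  have hDW : D / (2 * H) ≤ diam (univ : Set W) :=
    (div_le_self hDpos.le (by linarith)).trans (diam_mono (subset_univ _) (hbdd _))
  calc ENNReal.ofReal D ^ Q
      = ENNReal.ofReal ((2 * H) ^ Q / a') * ENNReal.ofReal (a' * (D / (2 * H)) ^ Q) := by
        rw [ENNReal.ofReal_rpow_of_nonneg hDpos.le hQ.le, ← ENNReal.ofReal_mul (by positivity),
          Real.div_rpow hDpos.le (by positivity)]
        congr 1
        field_simp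
    _ ≤ ENNReal.ofReal ((2 * H) ^ Q / a') * ν (φ '' ball z (ε / 2)) := by
        gcongr
        exact (hν (φ z) _ (by positivity) hDW).1.trans
          (measure_mono (hφ.ball_subset_image_ball (by linarith) hsurj z ε))

section Discretization

variable {Z W : Type*} [MetricSpace Z] [MetricSpace W] {φ : Z → W} {ρ : W → ℝ≥0∞} {ε : ℝ≥0}

/-- The weight of the ball of radius `ε` around `i` in the discretization of the pullback of the
density `ρ` under `φ`: the infimum of `ρ ∘ φ` on that ball times the factor by which `φ` scales the
ball. -/
def discreteWeight (φ : Z → W) (ρ : W → ℝ≥0∞) (ε : ℝ≥0) (i : Z) : ℝ≥0∞ :=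
  ballInf (ρ ∘ φ) ε i * (ediam (φ '' closedBall i ε) / ε)

/-- The discretization, over an `ε`-net `s`, of the pullback of the density `ρ` under `φ`. The
weights are spread over balls of twice the radius, so that a path which meets the ball of radius
`ε` around `i` and leaves the doubled ball collects at least `ε * discreteWeight φ ρ ε i`. -/
def discretePullback (φ : Z → W) (ρ : W → ℝ≥0∞) (ε : ℝ≥0) (s : Finset Z) (z : Z) : ℝ≥0∞ :=
  ∑ i ∈ s, (closedBall i (2 * ε)).indicator (fun _ => discreteWeight φ ρ ε i) z

theorem measurable_discretePullback [MeasurableSpace Z] [OpensMeasurableSpace Z] (φ : Z → W)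
    (ρ : W → ℝ≥0∞) (ε : ℝ≥0) (s : Finset Z) : Measurable (discretePullback φ ρ ε s) :=
  Finset.measurable_fun_sum _ fun _ _ =>
    measurable_const.indicator isClosed_closedBall.measurableSet

variable [MeasurableSpace Z] {μ : Measure Z} {Q a b : ℝ}

theorem discretePullback_rpow_le [OpensMeasurableSpace Z] (hμ : AhlforsRegular μ Q a b)
    (hQ : 1 ≤ Q) (ha : 0 < a) (hb : 0 ≤ b) (hε : 0 < ε) (hdiam : 3 * ε ≤ diam (univ : Set Z))
    {s : Finset Z} (hs : IsSeparated ε (s : Set Z)) (z : Z) :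
    discretePullback φ ρ ε s z ^ Q ≤ ENNReal.ofReal ((b / a * 6 ^ Q) ^ (Q - 1)) *
      ∑ i ∈ s, (closedBall i (2 * ε)).indicator (fun _ => discreteWeight φ ρ ε i ^ Q) z := by
  classical
  set T := s.filter fun i => z ∈ closedBall i (2 * ε)
  have hcard : (T.card : ℝ) ≤ b / a * 6 ^ Q := by
    have : (0 : ℝ) < ε := hε
    have h := hμ.card_le_of_isSeparated ha hb hε (T := T) (z := z) (r := 2 * ε)
      (hs.subset (Finset.coe_subset.2 (Finset.filter_subset _ _))) (by positivity)
      (fun i hi => mem_closedBall'.1 (Finset.mem_filter.1 hi).2) (by linarith)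
    rwa [show 2 * (2 * ε + ε) / (ε : ℝ) = 6 by field_simp; norm_num] at h
  simp only [discretePullback, indicator_apply, ← Finset.sum_filter]
  refine (ENNReal.rpow_sum_le_const_mul_sum_rpow T _ hQ).trans ?_
  gcongr
  rw [← ENNReal.ofReal_natCast, ENNReal.ofReal_rpow_of_nonneg (by positivity) (by linarith)]
  gcongr

variable [MeasurableSpace W] {ν : Measure W} {H a' b' : ℝ}

theorem discreteWeight_rpow_mul_measure_le [BoundedSpace W] [OpensMeasurableSpace W] {φ : Z ≃ₜ W}
    (hμ : AhlforsRegular μ Q a b) (hν : AhlforsRegular ν Q a' b')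
    (hφ : IsWeaklyQuasisymmetric H φ) (hH : 1 ≤ H) (hQ : 0 < Q) (hb : 0 ≤ b) (ha' : 0 < a')
    (hε : 0 < ε) (hdiam : 3 * ε ≤ diam (univ : Set Z)) (i : Z) :
    discreteWeight φ ρ ε i ^ Q * μ (closedBall i (2 * ε)) ≤
      ENNReal.ofReal (b * 3 ^ Q * ((2 * H) ^ Q / a')) *
        ∫⁻ w in φ '' ball i (ε / 2), ρ w ^ Q ∂ν := by
  have hε' : (0 : ℝ) < ε := hε
  have hmass : μ (closedBall i (2 * ε)) ≤ ENNReal.ofReal (b * 3 ^ Q) * ε ^ Q := by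
    refine (measure_mono (closedBall_subset_ball (by linarith))).trans
      ((hμ i (3 * ε) (by positivity) hdiam).2.trans_eq ?_)
    rw [Real.mul_rpow (by norm_num) hε'.le, ← mul_assoc, ENNReal.ofReal_mul (by positivity),
      ← ENNReal.ofReal_rpow_of_nonneg hε'.le hQ.le, ENNReal.ofReal_coe_nnreal]
  have hinf : ballInf (ρ ∘ φ) ε i ^ Q * ν (φ '' ball i (ε / 2)) ≤
      ∫⁻ w in φ '' ball i (ε / 2), ρ w ^ Q ∂ν := by
    rw [← setLIntegral_const]
    refine setLIntegral_mono' (φ.isOpenMap _ isOpen_ball).measurableSet ?_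
    rintro _ ⟨z, hz, rfl⟩
    gcongr
    exact ballInf_le (ρ := ρ ∘ φ) (ball_subset_ball (by linarith) hz)
  have hεtop : (ε : ℝ≥0∞) ^ Q ≠ ∞ := ENNReal.rpow_ne_top_of_nonneg hQ.le ENNReal.coe_ne_top
  have hεzero : (ε : ℝ≥0∞) ^ Q ≠ 0 :=
    (ENNReal.rpow_pos (ENNReal.coe_pos.2 hε) ENNReal.coe_ne_top).ne'
  calc discreteWeight φ ρ ε i ^ Q * μ (closedBall i (2 * ε))
      ≤ ballInf (ρ ∘ φ) ε i ^ Q * (ediam (φ '' closedBall i ε) ^ Q / ε ^ Q) *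
          (ENNReal.ofReal (b * 3 ^ Q) * ε ^ Q) := by
        rw [discreteWeight, ENNReal.mul_rpow_of_nonneg _ _ hQ.le,
          ENNReal.div_rpow_of_nonneg _ _ hQ.le]
        gcongr
    _ = ENNReal.ofReal (b * 3 ^ Q) *
          (ballInf (ρ ∘ φ) ε i ^ Q * (ediam (φ '' closedBall i ε) ^ Q / ε ^ Q * ε ^ Q)) := by ring
    _ ≤ ENNReal.ofReal (b * 3 ^ Q) * (ballInf (ρ ∘ φ) ε i ^ Q *
          (ENNReal.ofReal ((2 * H) ^ Q / a') * ν (φ '' ball i (ε / 2)))) := by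
        rw [ENNReal.div_mul_cancel hεzero hεtop]
        gcongr
        exact hφ.ediam_image_closedBall_rpow_le hH φ.surjective hQ ha' hν i ε
    _ = ENNReal.ofReal (b * 3 ^ Q * ((2 * H) ^ Q / a')) *
          (ballInf (ρ ∘ φ) ε i ^ Q * ν (φ '' ball i (ε / 2))) := by
        rw [ENNReal.ofReal_mul (p := b * 3 ^ Q) (by positivity)]
        ring
    _ ≤ _ := by gcongr

/-- The constant in the energy estimate for `discretePullback`: the overlap of the balls, their
mass, and the mass of their images each contribute one factor. -/
def energyConst (Q H a b a' : ℝ) : ℝ :=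
  (b / a * 6 ^ Q) ^ (Q - 1) * (b * 3 ^ Q * ((2 * H) ^ Q / a'))

theorem energyConst_pos (hH : 0 < H) (ha : 0 < a) (hb : 0 < b) (ha' : 0 < a') :
    0 < energyConst Q H a b a' := by
  unfold energyConst
  positivity

theorem lintegral_discretePullback_rpow_le [OpensMeasurableSpace Z] [BoundedSpace W]
    [OpensMeasurableSpace W] {φ : Z ≃ₜ W} (hμ : AhlforsRegular μ Q a b)
    (hν : AhlforsRegular ν Q a' b') (hφ : IsWeaklyQuasisymmetric H φ) (hH : 1 ≤ H) (hQ : 1 ≤ Q)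
    (ha : 0 < a) (hb : 0 ≤ b) (ha' : 0 < a') (hε : 0 < ε)
    (hdiam : 3 * ε ≤ diam (univ : Set Z)) {s : Finset Z} (hs : IsSeparated ε (s : Set Z)) :
    ∫⁻ z, discretePullback φ ρ ε s z ^ Q ∂μ ≤
      ENNReal.ofReal (energyConst Q H a b a') * ∫⁻ w, ρ w ^ Q ∂ν := by
  have hdisj : (s : Set Z).PairwiseDisjoint fun i => φ '' ball i (ε / 2 : ℝ) :=
    fun x hx y hy hxy => (disjoint_image_iff φ.injective).2
      (pairwiseDisjoint_ball_half_of_isSeparated hs hx hy hxy)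
  calc ∫⁻ z, discretePullback φ ρ ε s z ^ Q ∂μ
      ≤ ∫⁻ z, ENNReal.ofReal ((b / a * 6 ^ Q) ^ (Q - 1)) * ∑ i ∈ s,
          (closedBall i (2 * ε)).indicator (fun _ => discreteWeight φ ρ ε i ^ Q) z ∂μ :=
        lintegral_mono (discretePullback_rpow_le hμ hQ ha hb hε hdiam hs)
    _ = ENNReal.ofReal ((b / a * 6 ^ Q) ^ (Q - 1)) *
          ∑ i ∈ s, discreteWeight φ ρ ε i ^ Q * μ (closedBall i (2 * ε)) := by
        rw [lintegral_const_mul' _ _ ENNReal.ofReal_ne_top, lintegral_finsetSum]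
        · simp_rw [lintegral_indicator_const isClosed_closedBall.measurableSet]
        · exact fun i _ => measurable_const.indicator isClosed_closedBall.measurableSet
    _ ≤ ENNReal.ofReal ((b / a * 6 ^ Q) ^ (Q - 1)) *
          ∑ i ∈ s, ENNReal.ofReal (b * 3 ^ Q * ((2 * H) ^ Q / a')) *
            ∫⁻ w in φ '' ball i (ε / 2), ρ w ^ Q ∂ν := by
        refine mul_le_mul_right (Finset.sum_le_sum fun i _ => ?_) _
        exact discreteWeight_rpow_mul_measure_le hμ hν hφ hH (by linarith) hb ha' hε hdiam i
    _ = ENNReal.ofReal (energyConst Q H a b a') *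
          ∫⁻ w in ⋃ i ∈ s, φ '' ball i (ε / 2), ρ w ^ Q ∂ν := by
        rw [lintegral_biUnion_finset hdisj fun i _ => (φ.isOpenMap _ isOpen_ball).measurableSet,
          ← Finset.mul_sum, ← mul_assoc, energyConst,
          ENNReal.ofReal_mul (p := (b / a * 6 ^ Q) ^ (Q - 1)) (by positivity)]
    _ ≤ _ := mul_le_mul_right (setLIntegral_le_lintegral _ _) _

end Discretization

namespace IntervalPath

variable {Z W : Type*} [MetricSpace Z] [MetricSpace W] {γ : IntervalPath Z} {φ : C(Z, W)}
  {ρ : W → ℝ≥0∞} {ε : ℝ≥0}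

theorem Rectifiable.mul_ediam_image_closedBall_le (hγ : γ.Rectifiable) (hε : 0 < ε)
    {K : Set γ.domain} (hK : K.OrdConnected) {x y : γ.domain} (hx : x ∈ K) (hy : y ∈ K)
    (hxy : 2 * ε ≤ dist (γ.toFun x) (γ.toFun y)) {m : ℝ≥0∞}
    (hm : ∀ t ∈ K, m ≤ ballInf (ρ ∘ φ) (2 * ε) (γ.toFun t)) {i : Z} {t : γ.domain} (ht : t ∈ K)
    (hti : γ.toFun t ∈ closedBall i ε) :
    m * ediam (φ '' closedBall i ε) ≤ discreteWeight φ ρ ε i *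
      γ.arclengthMeasure (γ.toFun ⁻¹' closedBall i (2 * ε) ∩ K) := by
  rw [mem_closedBall] at hti
  have hm_le : m ≤ ballInf (ρ ∘ φ) ε i := (hm t ht).trans <| biInf_mono fun z hz =>
    ball_subset_ball' (by rw [dist_comm]; linarith) hz
  obtain ⟨y', hy', hfar⟩ : ∃ y' ∈ K, ε ≤ dist (γ.toFun t) (γ.toFun y') := by
    by_contra! hnear
    linarith [dist_triangle_left (γ.toFun x) (γ.toFun y) (γ.toFun t), hnear x hx, hnear y hy]
  have hlen : (ε : ℝ≥0∞) ≤ γ.arclengthMeasure (γ.toFun ⁻¹' closedBall i (2 * ε) ∩ K) := by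
    have h := hγ.ofReal_le_arclengthMeasure_inter_closedBall hK ht hy' ε.coe_nonneg hfar
    rw [ENNReal.ofReal_coe_nnreal, inter_comm] at h
    refine h.trans (measure_mono (inter_subset_inter_left K (preimage_mono ?_)))
    exact closedBall_subset_closedBall' (by linarith)
  calc m * ediam (φ '' closedBall i ε)
      = m * (ediam (φ '' closedBall i ε) / ε) * ε := by
        rw [mul_assoc, ENNReal.div_mul_cancel (ENNReal.coe_ne_zero.2 hε.ne') ENNReal.coe_ne_top]
    _ ≤ _ := by
        rw [discreteWeight]
        gcongr

theorem lintegral_discretePullback (γ : IntervalPath Z) (φ : Z → W) (ρ : W → ℝ≥0∞) (ε : ℝ≥0)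
    (s : Finset Z) (K : Set γ.domain) :
    ∫⁻ t in K, discretePullback φ ρ ε s (γ.toFun t) ∂γ.arclengthMeasure =
      ∑ i ∈ s, discreteWeight φ ρ ε i *
        γ.arclengthMeasure (γ.toFun ⁻¹' closedBall i (2 * ε) ∩ K) := by
  have hmeas : ∀ i, MeasurableSet (γ.toFun ⁻¹' closedBall i (2 * ε)) := fun i =>
    (isClosed_closedBall.preimage γ.continuous_toFun).measurableSet
  have hcomp : ∀ t, discretePullback φ ρ ε s (γ.toFun t) = ∑ i ∈ s,
      (γ.toFun ⁻¹' closedBall i (2 * ε)).indicator (fun _ => discreteWeight φ ρ ε i) t :=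
    fun t => rfl
  simp_rw [hcomp]
  rw [lintegral_finsetSum _ fun i _ => measurable_const.indicator (hmeas i)]
  refine Finset.sum_congr rfl fun i _ => ?_
  rw [lintegral_indicator_const (hmeas i), Measure.restrict_apply (hmeas i)]

theorem Rectifiable.mul_edist_le_lintegral_discretePullback (hγ : γ.Rectifiable) (hε : 0 < ε)
    {s : Finset Z} (hs : IsCover ε univ (s : Set Z)) {K : Set γ.domain} (hK : K.OrdConnected)
    {x y : γ.domain} (hx : x ∈ K) (hy : y ∈ K) (hxy : 2 * ε ≤ dist (γ.toFun x) (γ.toFun y))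
    {m : ℝ≥0∞} (hm : ∀ t ∈ K, m ≤ ballInf (ρ ∘ φ) (2 * ε) (γ.toFun t)) :
    m * edist (φ (γ.toFun x)) (φ (γ.toFun y)) ≤
      ∫⁻ t in K, discretePullback φ ρ ε s (γ.toFun t) ∂γ.arclengthMeasure := by
  classical
  let T := s.filter fun i => ∃ t ∈ K, γ.toFun t ∈ closedBall i ε
  have hcover : (fun t => φ (γ.toFun t)) '' K ⊆ ⋃ i ∈ T, φ '' closedBall i ε := by
    rintro _ ⟨t, ht, rfl⟩
    obtain ⟨i, hi, hti⟩ := mem_iUnion₂.1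
      (isCover_iff_subset_iUnion_closedBall.1 hs (mem_univ (γ.toFun t)))
    exact mem_biUnion (Finset.mem_filter.2 ⟨hi, t, ht, hti⟩) (mem_image_of_mem φ hti)
  have hpre : IsPreconnected ((fun t => φ (γ.toFun t)) '' K) :=
    (isPreconnected_of_ordConnected_subtype hK).image _
      (φ.continuous.comp γ.continuous_toFun).continuousOn
  calc m * edist (φ (γ.toFun x)) (φ (γ.toFun y))
      ≤ m * ∑ i ∈ T, ediam (φ '' closedBall i ε) := by
        gcongr
        exact (edist_le_ediam_of_mem (mem_image_of_mem _ hx) (mem_image_of_mem _ hy)).trans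
          (ediam_le_sum_of_isPreconnected hpre hcover)
    _ ≤ ∑ i ∈ T, discreteWeight φ ρ ε i *
          γ.arclengthMeasure (γ.toFun ⁻¹' closedBall i (2 * ε) ∩ K) := by
        rw [Finset.mul_sum]
        refine Finset.sum_le_sum fun i hi => ?_
        obtain ⟨-, t, ht, hti⟩ := Finset.mem_filter.1 hi
        exact hγ.mul_ediam_image_closedBall_le hε hK hx hy hxy hm ht hti
    _ ≤ ∑ i ∈ s, discreteWeight φ ρ ε i *
          γ.arclengthMeasure (γ.toFun ⁻¹' closedBall i (2 * ε) ∩ K) :=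
        Finset.sum_le_sum_of_subset (Finset.filter_subset _ _)
    _ = _ := (γ.lintegral_discretePullback φ ρ ε s K).symm

end IntervalPath

/-! ### Domination -/

theorem tsum_liminf_setLIntegral_le {α ι : Type*} [MeasurableSpace α] [Countable ι]
    {μ : Measure α} (f : ℕ → α → ℝ≥0∞) {s : ι → Set α} {t : Set α}
    (hs : ∀ i, MeasurableSet (s i)) (hd : Pairwise (Function.onFun Disjoint s))
    (hst : ∀ i, s i ⊆ t) :
    ∑' i, liminf (fun n => ∫⁻ x in s i, f n x ∂μ) atTop ≤
      liminf (fun n => ∫⁻ x in t, f n x ∂μ) atTop := by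
  let : MeasurableSpace ι := ⊤
  calc ∑' i, liminf (fun n => ∫⁻ x in s i, f n x ∂μ) atTop
      = ∫⁻ i, liminf (fun n => ∫⁻ x in s i, f n x ∂μ) atTop ∂Measure.count :=
        (lintegral_count _).symm
    _ ≤ liminf (fun n => ∫⁻ i, ∫⁻ x in s i, f n x ∂μ ∂Measure.count) atTop :=
        lintegral_liminf_le fun n => measurable_from_top
    _ ≤ liminf (fun n => ∫⁻ x in t, f n x ∂μ) atTop := by
        refine liminf_le_liminf (Eventually.of_forall fun n => ?_)
        change ∫⁻ i, ∫⁻ x in s i, f n x ∂μ ∂Measure.count ≤ _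
        rw [lintegral_count, ← lintegral_iUnion hs hd]
        exact lintegral_mono_set (iUnion_subset hst)

namespace IntervalPath

theorem Rectifiable.exists_ordConnected_partition {Z : Type*} [MetricSpace Z]
    {γ : IntervalPath Z} (hγ : γ.Rectifiable) {r : ℝ} (hr : 0 < r) :
    ∃ K : ℤ → Set γ.domain, (∀ k, (K k).OrdConnected) ∧
      Pairwise (Function.onFun Disjoint K) ∧ ⋃ k, K k = univ ∧
      ∀ k, ∀ t ∈ K k, ∀ t' ∈ K k, dist (γ.toFun t) (γ.toFun t') < r := by
  have hmono : Monotone fun t => ⌊γ.arclength t / r⌋ := fun s t hst => by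
    have := hγ.monotone_arclength hst
    dsimp only
    gcongr
  refine ⟨fun k => (fun t => ⌊γ.arclength t / r⌋) ⁻¹' {k},
    fun k => ordConnected_singleton.preimage_mono hmono,
    fun i j hij => Disjoint.preimage _ (disjoint_singleton.2 hij),
    eq_univ_of_forall fun t => mem_iUnion.2 ⟨_, rfl⟩, fun k t ht t' ht' => ?_⟩
  have hfloor : |γ.arclength t / r - γ.arclength t' / r| < 1 :=
    Int.abs_sub_lt_one_of_floor_eq_floor (Eq.trans ht (Eq.symm ht'))
  rw [← sub_div, abs_div, abs_of_pos hr, div_lt_one hr] at hfloor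
  exact (hγ.dist_le t t').trans_lt hfloor

variable {Z W : Type*} [MetricSpace Z] [MetricSpace W]

/-- The lower limit of the integrals of a sequence of densities over a part of a path. -/
def lowerIntegral (γ : IntervalPath Z) (σ : ℕ → Z → ℝ≥0∞) (K : Set γ.domain) : ℝ≥0∞ :=
  liminf (fun n => ∫⁻ t in K, σ n (γ.toFun t) ∂γ.arclengthMeasure) atTop

/-- The sequence `σ` of densities on `Z` asymptotically dominates the pullback of the density `ρ`
under `φ`: over every subarc `K` of `γ`, its lower integral is at least the distance between two
points of `φ ∘ γ` on `K`, weighted by any lower bound for `ρ` near `φ(γ(K))`. -/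
def Dominates (γ : IntervalPath Z) (φ : C(Z, W)) (ρ : W → ℝ≥0∞) (σ : ℕ → Z → ℝ≥0∞) : Prop :=
  ∀ K : Set γ.domain, K.OrdConnected → ∀ x ∈ K, ∀ y ∈ K, ∀ m : ℝ≥0∞, ∀ r > 0,
    (∀ t ∈ K, m ≤ ballInf ρ r (φ (γ.toFun t))) →
      m * edist (φ (γ.toFun x)) (φ (γ.toFun y)) ≤ γ.lowerIntegral σ K

variable {γ : IntervalPath Z} {φ : C(Z, W)} {ρ : W → ℝ≥0∞} {σ : ℕ → Z → ℝ≥0∞}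

namespace Dominates

theorem mul_eVariationOn_le (h : γ.Dominates φ ρ σ) (hγ : γ.Rectifiable)
    {K : Set γ.domain} (hK : K.OrdConnected) {m : ℝ≥0∞} {r : ℝ} (hr : 0 < r)
    (hm : ∀ t ∈ K, m ≤ ballInf ρ r (φ (γ.toFun t))) :
    m * eVariationOn (φ ∘ γ.toFun) K ≤ γ.lowerIntegral σ K := by
  have : NullSingletonClass γ.arclengthMeasure := ⟨hγ.arclengthMeasure_singleton⟩
  rw [eVariationOn, ENNReal.mul_iSup]
  refine iSup_le ?_
  rintro ⟨n, u, hu, huK⟩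
  have hIcc : ∀ i, Icc (u i) (u (i + 1)) ⊆ K := fun i => hK.out (huK _) (huK _)
  rw [Finset.mul_sum]
  calc ∑ i ∈ Finset.range n, m * edist (φ (γ.toFun (u (i + 1)))) (φ (γ.toFun (u i)))
      ≤ ∑ i ∈ Finset.range n, γ.lowerIntegral σ (Icc (u i) (u (i + 1))) :=
        Finset.sum_le_sum fun i _ => h _ ordConnected_Icc _ (right_mem_Icc.2 (hu i.le_succ)) _
          (left_mem_Icc.2 (hu i.le_succ)) m r hr fun t ht => hm t (hIcc i ht)
    _ = ∑ i ∈ Finset.range n, γ.lowerIntegral σ (Ioc (u i) (u (i + 1))) := by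
        simp only [lowerIntegral, setLIntegral_congr Ioc_ae_eq_Icc]
    _ ≤ ∑' i, γ.lowerIntegral σ (Ioc (u i) (u (i + 1))) := ENNReal.sum_le_tsum _
    _ ≤ γ.lowerIntegral σ K :=
        tsum_liminf_setLIntegral_le (fun n t => σ n (γ.toFun t)) (fun i => measurableSet_Ioc)
          (by simpa using hu.pairwise_disjoint_on_Ioc_succ)
          fun i => Ioc_subset_Icc_self.trans (hIcc i)

theorem setLIntegral_ballInf_le (h : γ.Dominates φ ρ σ) (hγ : γ.Rectifiable)
    (hφγ : (γ.map φ).Rectifiable) {K : Set γ.domain} (hK : K.OrdConnected) {r : ℝ} (hr : 0 < r)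
    (hdist : ∀ t ∈ K, ∀ t' ∈ K, dist (φ (γ.toFun t)) (φ (γ.toFun t')) < r) :
    ∫⁻ t in K, ballInf ρ (r + r) ((γ.map φ).toFun t) ∂(γ.map φ).arclengthMeasure ≤
      γ.lowerIntegral σ K := by
  set m := ⨆ t ∈ K, ballInf ρ (r + r) (φ (γ.toFun t))
  have hm_le : ∀ t ∈ K, m ≤ ballInf ρ r (φ (γ.toFun t)) := fun t ht =>
    iSup₂_le fun t' ht' => le_iInf₂ fun w hw => ballInf_le <|
      (dist_triangle _ _ _).trans_lt (add_lt_add hw (hdist t ht t' ht'))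
  calc ∫⁻ t in K, ballInf ρ (r + r) ((γ.map φ).toFun t) ∂(γ.map φ).arclengthMeasure
      ≤ ∫⁻ _ in K, m ∂(γ.map φ).arclengthMeasure :=
        setLIntegral_mono' hK.measurableSet <|
          le_iSup₂ (f := fun t (_ : t ∈ K) => ballInf ρ (r + r) (φ (γ.toFun t)))
    _ = m * (γ.map φ).arclengthMeasure K := setLIntegral_const _ _
    _ ≤ m * eVariationOn (φ ∘ γ.toFun) K :=
        mul_le_mul_right (hφγ.arclengthMeasure_le_eVariationOn hK) _
    _ ≤ γ.lowerIntegral σ K := h.mul_eVariationOn_le hγ hK hr hm_le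

theorem lintegral_ballInf_le (h : γ.Dominates φ ρ σ) (hγ : γ.Rectifiable)
    (hφγ : (γ.map φ).Rectifiable) {r : ℝ} (hr : 0 < r) :
    ∫⁻ t, ballInf ρ r ((γ.map φ).toFun t) ∂(γ.map φ).arclengthMeasure ≤
      γ.lowerIntegral σ univ := by
  obtain ⟨K, hK, hdisj, hcover, hdist⟩ := hφγ.exists_ordConnected_partition (half_pos hr)
  calc ∫⁻ t, ballInf ρ r ((γ.map φ).toFun t) ∂(γ.map φ).arclengthMeasure
      ≤ ∑' k, ∫⁻ t in K k, ballInf ρ r ((γ.map φ).toFun t) ∂(γ.map φ).arclengthMeasure := by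
        rw [← setLIntegral_univ, ← hcover]
        exact lintegral_iUnion_le _ _
    _ ≤ ∑' k, γ.lowerIntegral σ (K k) := by
        refine ENNReal.tsum_le_tsum fun k => ?_
        have := h.setLIntegral_ballInf_le hγ hφγ (hK k) (half_pos hr) (hdist k)
        rwa [add_halves] at this
    _ ≤ γ.lowerIntegral σ univ :=
        tsum_liminf_setLIntegral_le (fun n t => σ n (γ.toFun t))
          (fun k => (hK k).measurableSet) hdisj fun k => subset_univ _

theorem integral_map_le [MeasurableSpace W] [BorelSpace W] (h : γ.Dominates φ ρ σ)
    (hγ : γ.Rectifiable) (hφγ : (γ.map φ).Rectifiable) (hρ : LowerSemicontinuous ρ) :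
    (γ.map φ).integral ρ ≤ γ.lowerIntegral σ univ := by
  rw [hφγ.integral_eq hρ.measurable]
  simp_rw [← iSup_ballInf_of_lowerSemicontinuous hρ]
  rw [lintegral_iSup (f := fun n t => ballInf ρ (1 / ((n : ℝ) + 1)) ((γ.map φ).toFun t))
    (fun n => (measurable_ballInf _ _).comp (γ.map φ).continuous_toFun.measurable)
    fun n k hnk t => ballInf_anti (by gcongr) _]
  exact iSup_le fun n => h.lintegral_ballInf_le hγ hφγ (by positivity)

theorem one_le_liminf_integral [MeasurableSpace Z] [BorelSpace Z] [MeasurableSpace W]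
    [BorelSpace W] (h : γ.Dominates φ ρ σ) (hσ : ∀ n, Measurable (σ n)) (hγ : γ.Rectifiable)
    (hρ : LowerSemicontinuous ρ) {δ : ℝ≥0∞} (hδ : δ ≠ 0) (hδρ : ∀ w, δ ≤ ρ w)
    (hone : (γ.map φ).Rectifiable → 1 ≤ (γ.map φ).integral ρ) :
    1 ≤ liminf (fun n => γ.integral (σ n)) atTop := by
  have hlower : liminf (fun n => γ.integral (σ n)) atTop = γ.lowerIntegral σ univ := by
    simp only [lowerIntegral, setLIntegral_univ, hγ.integral_eq (hσ _)]
  rw [hlower]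
  by_cases hφγ : (γ.map φ).Rectifiable
  · exact (hone hφγ).trans (h.integral_map_le hγ hφγ hρ)
  · have htop : eVariationOn (φ ∘ γ.toFun) univ = ∞ := not_lt_top_iff.1 hφγ
    have := h.mul_eVariationOn_le hγ ordConnected_univ one_pos (m := δ)
      fun t _ => le_iInf₂ fun w _ => hδρ w
    rw [htop, ENNReal.mul_top hδ] at this
    exact le_top.trans this

end Dominates

end IntervalPath

/-! ### Comparison of moduli -/

theorem exists_lintegral_add_rpow_lt {α : Type*} [MeasurableSpace α] {ν : Measure α}
    [IsFiniteMeasure ν] {Q : ℝ} (hQ : 1 ≤ Q) {ρ : α → ℝ≥0∞} (hρ : Measurable ρ) {M : ℝ≥0∞}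
    (hM : ∫⁻ x, ρ x ^ Q ∂ν < M) : ∃ δ : ℝ≥0, 0 < δ ∧ ∫⁻ x, (ρ x + δ) ^ Q ∂ν < M := by
  have hQ0 : 0 < Q := by linarith
  let F : ℝ≥0 → ℝ≥0∞ := fun δ => ((∫⁻ x, ρ x ^ Q ∂ν) ^ (1 / Q) + δ * ν univ ^ (1 / Q)) ^ Q
  have hF : Tendsto F (𝓝[>] 0) (𝓝 (∫⁻ x, ρ x ^ Q ∂ν)) := by
    have hcont : Continuous F := ENNReal.continuous_rpow_const.comp <| continuous_const.add <|
      (ENNReal.continuous_mul_const (ENNReal.rpow_ne_top_of_nonneg (by positivity)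
        (measure_ne_top ν univ))).comp ENNReal.continuous_coe
    have hF0 : F 0 = ∫⁻ x, ρ x ^ Q ∂ν := by simp [F, ENNReal.rpow_inv_rpow hQ0.ne']
    exact hF0 ▸ hcont.continuousWithinAt
  obtain ⟨δ, hδM, hδ⟩ := ((hF.eventually_lt_const hM).and self_mem_nhdsWithin).exists
  refine ⟨δ, hδ, lt_of_le_of_lt ?_ hδM⟩
  have hMinkowski := ENNReal.lintegral_Lp_add_le (μ := ν) hρ.aemeasurable
    (aemeasurable_const (b := (δ : ℝ≥0∞))) hQ
  rw [lintegral_const, ENNReal.mul_rpow_of_nonneg _ _ (by positivity : 0 ≤ 1 / Q), one_div,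
    ENNReal.rpow_rpow_inv hQ0.ne', ENNReal.rpow_inv_le_iff hQ0] at hMinkowski
  simpa only [F, one_div, Pi.add_apply] using hMinkowski

theorem exists_lowerSemicontinuous_ge {α : Type*} [TopologicalSpace α] [MeasurableSpace α]
    [BorelSpace α] {ν : Measure α} [IsFiniteMeasure ν] [ν.WeaklyRegular] {Q : ℝ} (hQ : 1 ≤ Q)
    {ρ : α → ℝ≥0∞} (hρ : Measurable ρ) {M : ℝ≥0∞} (hM : ∫⁻ x, ρ x ^ Q ∂ν < M) :
    ∃ ρ' : α → ℝ≥0∞, LowerSemicontinuous ρ' ∧ ρ ≤ ρ' ∧ (∃ δ ≠ 0, ∀ x, δ ≤ ρ' x) ∧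
      ∫⁻ x, ρ' x ^ Q ∂ν < M := by
  have hQ0 : 0 < Q := by linarith
  obtain ⟨δ, hδ, hδM⟩ := exists_lintegral_add_rpow_lt hQ hρ hM
  obtain ⟨M', hδM', hM'M⟩ := exists_between hδM
  obtain ⟨g, hg, hg_lsc, hg_int⟩ := exists_le_lowerSemicontinuous_lintegral_ge ν
    (fun x => (ρ x + δ) ^ Q) ((hρ.add_const _).pow_const Q) (tsub_pos_of_lt hδM').ne'
  have hle : ∀ x, ρ x + δ ≤ g x ^ Q⁻¹ := fun x => (ENNReal.le_rpow_inv_iff hQ0).2 (hg x)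
  refine ⟨fun x => g x ^ Q⁻¹, ?_, fun x => le_self_add.trans (hle x),
    ⟨δ, ENNReal.coe_ne_zero.2 hδ.ne', fun x => le_add_self.trans (hle x)⟩, ?_⟩
  · exact ENNReal.continuous_rpow_const.comp_lowerSemicontinuous hg_lsc
      (ENNReal.monotone_rpow_of_nonneg (inv_nonneg.2 hQ0.le))
  · simp_rw [ENNReal.rpow_inv_rpow hQ0.ne']
    exact (hg_int.trans_eq (add_tsub_cancel_of_le hδM'.le)).trans_lt hM'M

theorem IntervalPath.Rectifiable.dominates_discretePullback {Z W : Type*} [MetricSpace Z]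
    [MetricSpace W] {γ : IntervalPath Z} (hγ : γ.Rectifiable) {φ : C(Z, W)}
    (hφ : UniformContinuous φ) {ρ : W → ℝ≥0∞} {ε : ℕ → ℝ≥0} (hε : ∀ n, 0 < ε n)
    (hε0 : Tendsto ε atTop (𝓝 0)) {s : ℕ → Finset Z}
    (hs : ∀ n, IsCover (ε n) univ (s n : Set Z)) :
    γ.Dominates φ ρ fun n => discretePullback φ ρ (ε n) (s n) := by
  intro K hK x hx y hy m r hr hm
  obtain hxy | hxy := eq_or_ne (γ.toFun x) (γ.toFun y)
  · simp [hxy]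
  obtain ⟨δ, hδ, hφδ⟩ := Metric.uniformContinuous_iff.1 hφ r hr
  have hε2 : Tendsto (fun n => 2 * (ε n : ℝ)) atTop (𝓝 0) := by
    simpa using (NNReal.tendsto_coe.2 hε0).const_mul 2
  refine le_liminf_of_le (by isBoundedDefault) ?_
  filter_upwards [hε2.eventually_lt_const hδ, hε2.eventually_lt_const (dist_pos.2 hxy)]
    with n hnδ hnxy
  refine hγ.mul_edist_le_lintegral_discretePullback (hε n) (hs n) hK hx hy hnxy.le
    fun t ht => (hm t ht).trans (le_iInf₂ fun z hz => ?_)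
  exact ballInf_le (hφδ (hz.trans hnδ))

section Comparison

variable {Z W : Type*} [MetricSpace Z] [CompactSpace Z] [MeasurableSpace Z]
  [MetricSpace W] [CompactSpace W] [MeasurableSpace W]
  {μ : Measure Z} {ν : Measure W} {Q H a b a' b' : ℝ}

theorem AhlforsRegular.isFiniteMeasure [Nontrivial W] (hν : AhlforsRegular ν Q a' b') :
    IsFiniteMeasure ν := by
  have hdiam : 0 < diam (univ : Set W) :=
    diam_pos nontrivial_univ (Bornology.IsBounded.all _)
  have : IsLocallyFiniteMeasure ν := ⟨fun w => ⟨_, ball_mem_nhds w hdiam,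
    (hν w _ hdiam le_rfl).2.trans_lt ENNReal.ofReal_lt_top⟩⟩
  infer_instance

variable [BorelSpace Z] [BorelSpace W]

theorem exists_dominating_sequence [Nontrivial Z] {φ : Z ≃ₜ W}
    (hμ : AhlforsRegular μ Q a b) (hν : AhlforsRegular ν Q a' b')
    (hφ : IsWeaklyQuasisymmetric H φ) (hQ : 1 ≤ Q) (ha : 0 < a) (hb : 0 ≤ b) (ha' : 0 < a')
    (ρ : W → ℝ≥0∞) :
    ∃ σ : ℕ → Z → ℝ≥0∞, (∀ n, Measurable (σ n)) ∧
      (∀ n, ∫⁻ z, σ n z ^ Q ∂μ ≤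
        ENNReal.ofReal (energyConst Q H a b a') * ∫⁻ w, ρ w ^ Q ∂ν) ∧
      ∀ γ : IntervalPath Z, γ.Rectifiable → γ.Dominates φ ρ σ := by
  have hdiam : 0 < diam (univ : Set Z) :=
    diam_pos nontrivial_univ (Bornology.IsBounded.all _)
  obtain ⟨ε, -, hε, hε0⟩ := exists_seq_strictAnti_tendsto'
    (Real.toNNReal_pos.2 (div_pos hdiam three_pos))
  have hεdiam : ∀ n, 3 * (ε n : ℝ) ≤ diam (univ : Set Z) := fun n => by
    have := Real.lt_toNNReal_iff_coe_lt.1 (hε n).2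
    linarith
  choose s hs hcover using fun n =>
    exists_finset_isSeparated_isCover (isCompact_univ (X := Z)).totallyBounded (hε n).1.ne'
  refine ⟨fun n => discretePullback φ ρ (ε n) (s n), fun n => measurable_discretePullback _ _ _ _,
    fun n => lintegral_discretePullback_rpow_le hμ hν hφ (hφ.one_le φ.injective) hQ ha hb ha'
      (hε n).1 (hεdiam n) (hs n),
    fun γ hγ => hγ.dominates_discretePullback
      (CompactSpace.uniformContinuous_of_continuous φ.continuous) (fun n => (hε n).1) hε0 hcover⟩

theorem AdmissibleFor.pathModulus_le_energyConst_mul [Nontrivial Z] {φ : Z ≃ₜ W} {ρ : W → ℝ≥0∞}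
    {Γ : Set (IntervalPath Z)} (hρ : AdmissibleFor ρ (IntervalPath.map (φ : C(Z, W)) '' Γ))
    (hμ : AhlforsRegular μ Q a b) (hν : AhlforsRegular ν Q a' b')
    (hφ : IsWeaklyQuasisymmetric H φ) (hQ : 1 < Q) (ha : 0 < a) (hb : 0 ≤ b) (ha' : 0 < a')
    {M : ℝ≥0∞} (hM : ∫⁻ w, ρ w ^ Q ∂ν < M) :
    pathModulus μ Q Γ ≤ ENNReal.ofReal (energyConst Q H a b a') * M := by
  have : Nontrivial W := φ.symm.surjective.nontrivial
  have : IsFiniteMeasure ν := hν.isFiniteMeasure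
  obtain ⟨ρ', hρ'_lsc, hρρ', ⟨δ, hδ, hδρ'⟩, hρ'M⟩ :=
    exists_lowerSemicontinuous_ge hQ.le hρ.1 hM
  have hρ' := hρ.mono hρ'_lsc.measurable hρρ'
  obtain ⟨σ, hσ, hσ_energy, hσ_dom⟩ :=
    exists_dominating_sequence hμ hν hφ hQ.le ha hb ha' ρ'
  refine pathModulus_le_of_one_le_liminf_integral hQ hσ (fun n => ?_) fun γ hγ hrect => ?_
  · exact (hσ_energy n).trans (mul_le_mul_right hρ'M.le _)
  · exact (hσ_dom γ hrect).one_le_liminf_integral hσ hrect hρ'_lsc hδ hδρ'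
      (hρ'.2 _ (mem_image_of_mem _ hγ))

theorem pathModulus_le_energyConst_mul {φ : Z ≃ₜ W} (hμ : AhlforsRegular μ Q a b)
    (hν : AhlforsRegular ν Q a' b') (hφ : IsWeaklyQuasisymmetric H φ) (hH : 0 < H) (hQ : 1 < Q)
    (ha : 0 < a) (hb : 0 < b) (ha' : 0 < a') (Γ : Set (IntervalPath Z)) :
    pathModulus μ Q Γ ≤ ENNReal.ofReal (energyConst Q H a b a') *
      pathModulus ν Q (IntervalPath.map (φ : C(Z, W)) '' Γ) := by
  have hC : ENNReal.ofReal (energyConst Q H a b a') ≠ 0 :=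
    (ENNReal.ofReal_pos.2 (energyConst_pos hH ha hb ha')).ne'
  obtain hZ | hZ := subsingleton_or_nontrivial Z
  · have : Subsingleton W := φ.symm.injective.subsingleton
    obtain rfl | hΓ := Γ.eq_empty_or_nonempty
    · simp [pathModulus_empty μ (zero_lt_one.trans hQ)]
    · simp [pathModulus_eq_top_of_subsingleton ν Q (hΓ.image _), ENNReal.mul_top hC]
  · rw [← ENNReal.inv_mul_le_iff hC ENNReal.ofReal_ne_top]
    refine le_of_forall_gt_imp_ge_of_dense fun M hM => ?_
    obtain ⟨ρ, hρ, hρM⟩ := exists_admissibleFor_lt hM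
    rw [ENNReal.inv_mul_le_iff hC ENNReal.ofReal_ne_top]
    exact hρ.pathModulus_le_energyConst_mul hμ hν hφ hQ ha hb.le ha' hρM

end Comparison

theorem IntervalPath.image_map_symm_image_map {Z W : Type*} [TopologicalSpace Z]
    [TopologicalSpace W] (φ : Z ≃ₜ W) (Γ : Set (IntervalPath Z)) :
    IntervalPath.map (φ.symm : C(W, Z)) '' (IntervalPath.map (φ : C(Z, W)) '' Γ) = Γ := by
  have h : ∀ γ : IntervalPath Z, (γ.map (φ : C(Z, W))).map (φ.symm : C(W, Z)) = γ := by
    rintro ⟨I, hI, hne, γ, hγ⟩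
    simp only [IntervalPath.map, ← Function.comp_assoc]
    congr
    ext t
    simp
  simp only [image_image, h, image_id']

section Quasisymmetric

theorem homeomorph_nnreal_strictMono (η : ℝ≥0 ≃ₜ ℝ≥0) : StrictMono η := by
  refine (η.continuous.strictMono_of_inj η.injective).resolve_right fun hanti => ?_
  obtain ⟨t, ht⟩ := η.surjective (η 0 + 1)
  exact (ht ▸ hanti.antitone (zero_le : 0 ≤ t)).not_gt (lt_add_one _)

theorem exists_pos_homeomorph_nnreal_lt (η : ℝ≥0 ≃ₜ ℝ≥0) {s : ℝ≥0} (hs : 0 < s) :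
    ∃ t, 0 < t ∧ η t < s := by
  refine ⟨η.symm (s / 2), ?_, by simpa using half_lt_self hs⟩
  exact zero_le.trans_lt (homeomorph_nnreal_strictMono η.symm (half_pos hs))

variable {Z W : Type*} [MetricSpace Z] [MetricSpace W] {η : ℝ≥0 → ℝ≥0}

theorem IsQuasisymmetric.isWeaklyQuasisymmetric {φ : Z → W} (h : IsQuasisymmetric η φ) :
    IsWeaklyQuasisymmetric (η 2) φ := fun z z' z'' hz => h z z' z'' 2 (by simpa using hz)

theorem IsQuasisymmetric.isWeaklyQuasisymmetric_symm {φ : Z ≃ₜ W} (h : IsQuasisymmetric η φ)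
    {t : ℝ≥0} (ht : 0 < t) (hηt : η t < 1 / 2) : IsWeaklyQuasisymmetric (t⁻¹ : ℝ) φ.symm := by
  intro w w' w'' hw
  by_contra! hlt
  rw [inv_mul_lt_iff₀ (NNReal.coe_pos.2 ht)] at hlt
  have hη := h (φ.symm w) (φ.symm w'') (φ.symm w') t hlt.le
  simp only [Homeomorph.apply_symm_apply] at hη
  have hηt' : (η t : ℝ) < 1 / 2 := by exact_mod_cast hηt
  have hzero : dist w w' = 0 := by nlinarith [dist_nonneg (x := w) (y := w')]
  rw [dist_eq_zero.1 hzero, dist_self, mul_zero] at hlt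
  exact hlt.not_ge dist_nonneg

end Quasisymmetric

end

theorem mainTheorem6_general (Q H H' : ℝ) (hQ : 1 < Q) (hH : 0 < H) (hH' : 0 < H')
    (aZ bZ aW bW : ℝ) (haZ : 0 < aZ) (hbZ : 0 < bZ) (haW : 0 < aW) (hbW : 0 < bW) :
    ∃ c C : ℝ≥0, 0 < c ∧ 0 < C ∧
      ∀ (Z : Type*) [MetricSpace Z] [CompactSpace Z] [MeasurableSpace Z] [BorelSpace Z]
        (μ : Measure Z) (W : Type*) [MetricSpace W] [CompactSpace W] [MeasurableSpace W]
        [BorelSpace W] (ν : Measure W),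
        AhlforsRegular μ Q aZ bZ → AhlforsRegular ν Q aW bW →
        ∀ φ : Z ≃ₜ W, IsWeaklyQuasisymmetric H φ → IsWeaklyQuasisymmetric H' φ.symm →
          ∀ Γ : Set (IntervalPath Z),
            c * pathModulus μ Q Γ ≤ pathModulus ν Q (IntervalPath.map (φ : C(Z, W)) '' Γ) ∧
            pathModulus ν Q (IntervalPath.map (φ : C(Z, W)) '' Γ) ≤ C * pathModulus μ Q Γ := by
  have hC₁ := Real.toNNReal_pos.2 (energyConst_pos (Q := Q) hH haZ hbZ haW)
  have hC₂ := Real.toNNReal_pos.2 (energyConst_pos (Q := Q) hH' haW hbW haZ)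
  refine ⟨_, _, inv_pos.2 hC₁, hC₂, fun Z _ _ _ _ μ W _ _ _ _ ν hμ hν φ hφ hφ' Γ => ⟨?_, ?_⟩⟩
  · rw [ENNReal.coe_inv hC₁.ne', ENNReal.inv_mul_le_iff (by simpa using hC₁) ENNReal.coe_ne_top]
    exact pathModulus_le_energyConst_mul hμ hν hφ hH hQ haZ hbZ haW Γ
  · have h := pathModulus_le_energyConst_mul hν hμ hφ' hH' hQ haW hbW haZ
      (IntervalPath.map (φ : C(Z, W)) '' Γ)
    rwa [IntervalPath.image_map_symm_image_map] at h

theorem mainTheorem6 (Q : ℝ) (hQ : 1 < Q) (η : ℝ≥0 ≃ₜ ℝ≥0)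
    (aZ bZ aW bW : ℝ) (haZ : 0 < aZ) (hbZ : 0 < bZ) (haW : 0 < aW) (hbW : 0 < bW) :
    ∃ c C : ℝ≥0, 0 < c ∧ 0 < C ∧
      ∀ (Z : Type*) [MetricSpace Z] [CompactSpace Z] [ConnectedSpace Z]
        [MeasurableSpace Z] [BorelSpace Z] (μ : Measure Z)
        (W : Type*) [MetricSpace W] [CompactSpace W] [ConnectedSpace W]
        [MeasurableSpace W] [BorelSpace W] (ν : Measure W),
        AhlforsRegular μ Q aZ bZ → AhlforsRegular ν Q aW bW →
        ∀ φ : Z ≃ₜ W, IsQuasisymmetric η φ →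
          ∀ Γ : Set (IntervalPath Z),
            c * pathModulus μ Q Γ ≤ pathModulus ν Q (IntervalPath.map (φ : C(Z, W)) '' Γ) ∧
            pathModulus ν Q (IntervalPath.map (φ : C(Z, W)) '' Γ) ≤ C * pathModulus μ Q Γ := by
  have hη2 : 0 < η 2 := zero_le.trans_lt (homeomorph_nnreal_strictMono η two_pos)
  obtain ⟨t, ht, hηt⟩ := exists_pos_homeomorph_nnreal_lt η (show (0 : ℝ≥0) < 1 / 2 by simp)
  obtain ⟨c, C, hc, hC, h⟩ := mainTheorem6_general Q (η 2) (t⁻¹ : ℝ) hQ (NNReal.coe_pos.2 hη2)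
    (inv_pos.2 (NNReal.coe_pos.2 ht)) aZ bZ aW bW haZ hbZ haW hbW
  exact ⟨c, C, hc, hC, fun Z _ _ _ _ _ μ W _ _ _ _ _ ν hμ hν φ hφ =>
    h Z μ W ν hμ hν φ hφ.isWeaklyQuasisymmetric (hφ.isWeaklyQuasisymmetric_symm ht hηt)⟩
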